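/- Let $n\ge 0$, let $\mathbb G_a=(\mathbb C,+)$, let $\rho:\mathbb G_a^n\to \mathrm{GL}_{n+2}(\mathbb C)$ be a faithful rational representation and let $v\in\mathbb C^{n+2}$ be a cyclic vector, i.e. $\langle\rho(\mathbb G_a^n)v\rangle=\mathbb C^{n+2}$. Let $\tau:\mathbb C[S_1,\dots,S_n]\to \mathrm{Mat}_{n+2}(\mathbb C)$ be the algebra homomorphism sending $S_i$ to the operator $d\rho(S_i)$ of the differential of $\rho$ in the $i$-th coordinate direction, let $I=\{a:\tau(a)v=0\}$ and $R=\mathbb C[S_1,\dots,S_n]/I$. Then $R$ is a local algebra, with maximal ideal denoted $\mathfrak m_R$, and $a\mapsto\tau(a)v$ induces a linear isomorphism $R\cong\mathbb C^{n+2}$ taking $1$ to $v$, by which we identify the two spaces. Call a $\mathbb C$-basis $\mu_1,\dots,\mu_{n+2}$ of $R$ proper if $\mu_1=1$; the vectors $\mu_2,\dots,\mu_{n+1}$ span the same subspace as the images of $S_1,\dots,S_n$ in $R$; $\mu_{n+2}$ is a polynomial in the other basis vectors; and every power of $\mathfrak m_R$ is spanned by some of the basis vectors. For a basis $\mu$ let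 $B_0$ be the symmetric bilinear form on $R$ with $$B_0(\mu_1,\mu_i)=-\delta_{i,n+2},\qquad B_0(\mu_i,\mu_{n+2})=-\delta_{i1}\qquad(1\le i\le n+2),$$ and, for $2\le i,j\le n+1$, $B_0(\mu_i,\mu_j)=a_{ij}$, where $a_{ij}$ is the coefficient of $\mu_{n+2}$ in the expansion of $\mu_i\mu_j$ in the basis $\mu$ (so that $\mu_i\mu_j=a_{ij}\mu_{n+2}$ when $\mathfrak m_R^2=\langle\mu_{n+2}\rangle$). Then proper bases of $R$ exist, and for every proper basis the following holds. The Zariski closure in $\mathbb P^{n+1}=\mathbb P(\mathbb C^{n+2})$ of the orbit $\mathbb G_a^n\langle v\rangle$ of the line spanned by $v$ is a nondegenerate quadric (the zero locus of a nondegenerate quadratic form on $\mathbb C^{n+2}$) if and only if $\dim_{\mathbb C}\mathfrak m_R^2=1$ and the form $B_0$ is nondegenerate. In this case the orbit closure is the quadric given by the equation $B_0(u,u)=0$, $u\in R\cong\mathbb C^{n+2}$. -/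

import Mathlib

open scoped Matrix LinearAlgebra.Projectivization Polynomial

/-! ### Rational representations of the vector group and the associated local algebra -/

/-- A homomorphism `𝔾ₐⁿ → GL_l(ℂ)` is rational (a morphism of algebraic groups) if its matrix
entries are polynomial functions on `𝔾ₐⁿ = ℂⁿ`. -/
def IsRationalRep {n l : ℕ} (ρ : Multiplicative (Fin n → ℂ) →* GL (Fin l) ℂ) : Prop :=
  ∃ M : Matrix (Fin l) (Fin l) (MvPolynomial (Fin n) ℂ), ∀ (a : Fin n → ℂ) (j k : Fin l),
    (ρ (Multiplicative.ofAdd a)).1 j k = MvPolynomial.eval a (M j k)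

/-- A pair `(ρ, v)`: a rational representation `ρ : 𝔾ₐⁿ → GL_l(ℂ)` and a cyclic vector `v ∈ ℂˡ`,
that is, `⟨ρ(𝔾ₐⁿ) v⟩ = ℂˡ`. -/
structure CyclicRep (n l : ℕ) where
  ρ : Multiplicative (Fin n → ℂ) →* GL (Fin l) ℂ
  rational : IsRationalRep ρ
  v : Fin l → ℂ
  cyclic : Submodule.span ℂ (Set.range fun a => (ρ a).1 *ᵥ v) = ⊤

namespace CyclicRep

variable {n l : ℕ}

/-- The representation is faithful. -/
def Faithful (P : CyclicRep n l) : Prop := Function.Injective P.ρ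

/-- The matrix of `ρ` on the `i`-th one-parameter subgroup. -/
noncomputable def oneParam (P : CyclicRep n l) (i : Fin n) (t : ℂ) : Matrix (Fin l) (Fin l) ℂ :=
  (P.ρ (Multiplicative.ofAdd (Pi.single i t))).1

/-- The operator `dρ(S_i)`: the derivative at `0` of `ρ` along the `i`-th coordinate of `𝔾ₐⁿ`. -/
noncomputable def dρ (P : CyclicRep n l) (i : Fin n) : Matrix (Fin l) (Fin l) ℂ :=
  Matrix.of fun j k => deriv (fun t : ℂ => P.oneParam i t j k) 0

theorem oneParam_zero (P : CyclicRep n l) (i : Fin n) : P.oneParam i 0 = 1 := by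
  simp [oneParam]

theorem oneParam_add (P : CyclicRep n l) (i : Fin n) (s t : ℂ) :
    P.oneParam i (s + t) = P.oneParam i s * P.oneParam i t := by
  simp [oneParam, Pi.single_add, ofAdd_add]

theorem oneParam_comm (P : CyclicRep n l) (i j : Fin n) (s t : ℂ) :
    P.oneParam i s * P.oneParam j t = P.oneParam j t * P.oneParam i s := by
  simp only [oneParam, ← Units.val_mul, ← map_mul]
  rw [mul_comm]

theorem exists_poly (P : CyclicRep n l) (i : Fin n) :
    ∃ p : Fin l → Fin l → ℂ[X], ∀ t j k, P.oneParam i t j k = (p j k).eval t := by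
  obtain ⟨M, hM⟩ := P.rational
  refine ⟨fun j k => MvPolynomial.aeval
    (fun m : Fin n => if m = i then (Polynomial.X : ℂ[X]) else 0) (M j k), fun t j k => ?_⟩
  beta_reduce
  rw [oneParam, hM, ← Polynomial.coe_evalRingHom, MvPolynomial.aeval_def, MvPolynomial.eval_eq',
    MvPolynomial.eval₂_eq', map_sum]
  refine Finset.sum_congr rfl fun d _ => ?_
  rw [map_mul, map_prod]
  congr 1
  · simp
  · refine Finset.prod_congr rfl fun m _ => ?_
    by_cases h : m = i
    · subst h; simp
    · simp [h]

theorem oneParam_hasDerivAt (P : CyclicRep n l) (i : Fin n) (j k : Fin l) :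
    HasDerivAt (fun t : ℂ => P.oneParam i t j k) (P.dρ i j k) 0 := by
  obtain ⟨p, hp⟩ := P.exists_poly i
  have h : DifferentiableAt ℂ (fun t : ℂ => P.oneParam i t j k) 0 := by
    simp only [hp]
    exact (p j k).differentiableAt
  exact h.hasDerivAt

theorem commute_dρ_of_oneParam (P : CyclicRep n l) (i : Fin n) (B : Matrix (Fin l) (Fin l) ℂ)
    (h : ∀ t, P.oneParam i t * B = B * P.oneParam i t) : P.dρ i * B = B * P.dρ i := by
  ext a b
  have h1 : HasDerivAt (fun t : ℂ => (P.oneParam i t * B) a b) ((P.dρ i * B) a b) 0 := by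
    simp only [Matrix.mul_apply]
    exact HasDerivAt.fun_sum fun m _ => (P.oneParam_hasDerivAt i a m).mul_const _
  have h2 : HasDerivAt (fun t : ℂ => (B * P.oneParam i t) a b) ((B * P.dρ i) a b) 0 := by
    simp only [Matrix.mul_apply]
    exact HasDerivAt.fun_sum fun m _ => (P.oneParam_hasDerivAt i m b).const_mul _
  simp only [h] at h1
  exact h1.unique h2

theorem dρ_comm (P : CyclicRep n l) (i j : Fin n) : P.dρ i * P.dρ j = P.dρ j * P.dρ i :=
  P.commute_dρ_of_oneParam i _ fun t =>
    (P.commute_dρ_of_oneParam j _ fun s => P.oneParam_comm j i s t).symm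

/-- Along a one-parameter subgroup `ρ` is the exponential of the nilpotent matrix `dρ(S_i)`. -/
theorem oneParam_eq_exp (P : CyclicRep n l) (i : Fin n) : ∃ D : ℕ, P.dρ i ^ D = 0 ∧
    ∀ t, P.oneParam i t = ∑ d ∈ Finset.range D, (t ^ d / d.factorial) • P.dρ i ^ d := by
  obtain ⟨p, hp⟩ := P.exists_poly i
  have hder : ∀ t j k, (p j k).derivative.eval t = ∑ m, (p j m).eval t * P.dρ i m k := by
    intro t j k
    have h1 : HasDerivAt (fun s : ℂ => P.oneParam i (t + s) j k)
        (∑ m, P.oneParam i t j m * P.dρ i m k) 0 := by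
      simp only [oneParam_add, Matrix.mul_apply]
      exact HasDerivAt.fun_sum fun m _ => (P.oneParam_hasDerivAt i m k).const_mul _
    have h2 : HasDerivAt (fun s : ℂ => P.oneParam i (t + s) j k)
        ((p j k).derivative.eval t) 0 := by
      simp only [hp]
      have := (p j k).hasDerivAt (t + 0)
      simpa using this.comp_const_add t 0
    rw [h2.unique h1]
    simp only [hp]
  have hpol : ∀ j k, (p j k).derivative = ∑ m, p j m * Polynomial.C (P.dρ i m k) := by
    intro j k
    refine Polynomial.funext fun t => ?_
    rw [hder, Polynomial.eval_finsetSum]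
    simp
  have hcoeff : ∀ d j k, (p j k).coeff d = (P.dρ i ^ d) j k / d.factorial := by
    intro d
    induction d with
    | zero =>
      intro j k
      have := hp 0 j k
      rw [oneParam_zero] at this
      simp [Polynomial.coeff_zero_eq_eval_zero, ← this]
    | succ d ih =>
      intro j k
      have h := congrArg (fun q => Polynomial.coeff q d) (hpol j k)
      simp only [Polynomial.coeff_derivative, Polynomial.finsetSum_coeff,
        Polynomial.coeff_mul_C, ih] at h
      have hd : ((d : ℂ) + 1) ≠ 0 := by exact_mod_cast Nat.succ_ne_zero d
      have hf : ((d.factorial : ℕ) : ℂ) ≠ 0 := by exact_mod_cast d.factorial_ne_zero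
      rw [pow_succ, Matrix.mul_apply, Nat.factorial_succ]
      push_cast
      rw [eq_div_iff (mul_ne_zero hd hf), ← mul_assoc, h, Finset.sum_mul]
      refine Finset.sum_congr rfl fun m _ => ?_
      field_simp
  obtain ⟨D, hD⟩ : ∃ D : ℕ, ∀ j k, (p j k).natDegree < D := by
    refine ⟨(∑ j, ∑ k, (p j k).natDegree) + 1, fun j k => Nat.lt_succ_of_le ?_⟩
    exact (Finset.single_le_sum (f := fun k => (p j k).natDegree) (fun _ _ => Nat.zero_le _)
      (Finset.mem_univ k)).trans (Finset.single_le_sum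
        (f := fun j => ∑ k, (p j k).natDegree) (fun _ _ => Nat.zero_le _) (Finset.mem_univ j))
  refine ⟨D, ?_, fun t => ?_⟩
  · ext j k
    have h := hcoeff D j k
    rw [Polynomial.coeff_eq_zero_of_natDegree_lt (hD j k)] at h
    have hf : ((D.factorial : ℕ) : ℂ) ≠ 0 := by exact_mod_cast D.factorial_ne_zero
    have := (div_eq_zero_iff.mp h.symm).resolve_right hf
    simpa using this
  · ext j k
    rw [hp, Polynomial.eval_eq_sum_range' (hD j k), Matrix.sum_apply]
    refine Finset.sum_congr rfl fun d _ => ?_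
    rw [hcoeff, Matrix.smul_apply, smul_eq_mul]
    ring

theorem adjoin_comm (P : CyclicRep n l) :
    IsMulCommutative (Algebra.adjoin ℂ (Set.range P.dρ)) :=
  Algebra.isMulCommutative_adjoin ℂ (by
    rintro _ ⟨i, rfl⟩ _ ⟨j, rfl⟩
    exact P.dρ_comm i j)

open scoped IsMulCommutative in
/-- The algebra homomorphism `τ : U(𝔤) = ℂ[S_1, …, S_n] → Mat_{l × l}(ℂ)` with `τ(S_i) = dρ(S_i)`
(see `τ_X`), constructed through the commutative subalgebra generated by the `dρ(S_i)`. -/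
noncomputable def τ (P : CyclicRep n l) :
    MvPolynomial (Fin n) ℂ →ₐ[ℂ] Matrix (Fin l) (Fin l) ℂ :=
  haveI := P.adjoin_comm
  (Algebra.adjoin ℂ (Set.range P.dρ)).val.comp
    (MvPolynomial.aeval fun i => ⟨P.dρ i, Algebra.subset_adjoin ⟨i, rfl⟩⟩)

open scoped IsMulCommutative in
@[simp] theorem τ_X (P : CyclicRep n l) (i : Fin n) : P.τ (MvPolynomial.X i) = P.dρ i := by
  have := P.adjoin_comm
  change ((MvPolynomial.aeval
    (fun i => (⟨P.dρ i, Algebra.subset_adjoin ⟨i, rfl⟩⟩ : Algebra.adjoin ℂ (Set.range P.dρ)))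
    (MvPolynomial.X i) : Algebra.adjoin ℂ (Set.range P.dρ)) : Matrix (Fin l) (Fin l) ℂ) = _
  rw [MvPolynomial.aeval_X]

/-- The linear map `a ↦ τ(a) v`. -/
noncomputable def evalV (P : CyclicRep n l) : MvPolynomial (Fin n) ℂ →ₗ[ℂ] (Fin l → ℂ) where
  toFun a := P.τ a *ᵥ P.v
  map_add' a b := by rw [map_add, Matrix.add_mulVec]
  map_smul' c a := by rw [map_smul, Matrix.smul_mulVec, RingHom.id_apply]

/-- The ideal `I = {a ∈ ℂ[S_1, …, S_n] : τ(a) v = 0}`. -/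
noncomputable def annIdeal (P : CyclicRep n l) : Ideal (MvPolynomial (Fin n) ℂ) where
  carrier := {a | P.τ a *ᵥ P.v = 0}
  add_mem' {a b} ha hb := by
    simp only [Set.mem_ofPred_eq] at ha hb ⊢
    rw [map_add, Matrix.add_mulVec, ha, hb, add_zero]
  zero_mem' := by simp
  smul_mem' c a ha := by
    simp only [Set.mem_ofPred_eq] at ha ⊢
    rw [smul_eq_mul, map_mul, ← Matrix.mulVec_mulVec, ha, Matrix.mulVec_zero]

/-- The algebra `R = ℂ[S_1, …, S_n] / I` associated with the pair `(ρ, v)`. -/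
abbrev R (P : CyclicRep n l) : Type := MvPolynomial (Fin n) ℂ ⧸ P.annIdeal

/-- The image of the generator `S_i` in `R`. -/
noncomputable def S (P : CyclicRep n l) (i : Fin n) : P.R :=
  Ideal.Quotient.mk P.annIdeal (MvPolynomial.X i)

theorem evalV_surjective (P : CyclicRep n l) : Function.Surjective P.evalV := by
  have hstab : ∀ (i : Fin n) (t : ℂ), ∀ w ∈ LinearMap.range P.evalV,
      P.oneParam i t *ᵥ w ∈ LinearMap.range P.evalV := by
    intro i t w hw
    obtain ⟨D, -, hD⟩ := P.oneParam_eq_exp i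
    rw [hD, Matrix.sum_mulVec]
    refine Submodule.sum_mem _ fun d _ => ?_
    rw [Matrix.smul_mulVec]
    refine Submodule.smul_mem _ _ ?_
    obtain ⟨q, rfl⟩ := hw
    refine ⟨MvPolynomial.X i ^ d * q, ?_⟩
    simp [evalV, Matrix.mulVec_mulVec]
  have hall : ∀ (s : Finset (Fin n)) (a : Fin n → ℂ),
      (P.ρ (Multiplicative.ofAdd (∑ i ∈ s, Pi.single i (a i)))).1 *ᵥ P.v
        ∈ LinearMap.range P.evalV := by
    intro s a
    induction s using Finset.induction_on with
    | empty => exact ⟨1, by simp [evalV]⟩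
    | insert i s hi ih =>
      rw [Finset.sum_insert hi, ofAdd_add, map_mul, Units.val_mul, ← Matrix.mulVec_mulVec]
      exact hstab i (a i) _ ih
  rw [← LinearMap.range_eq_top, eq_top_iff, ← P.cyclic, Submodule.span_le]
  rintro _ ⟨a, rfl⟩
  have := hall Finset.univ a.toAdd
  rwa [Finset.univ_sum_single] at this

theorem ker_evalV (P : CyclicRep n l) :
    LinearMap.ker P.evalV = P.annIdeal.restrictScalars ℂ := rfl

/-- The isomorphism `R = U(𝔤)/I ≅ τ(U(𝔤)) v = ℂˡ`, sending the class of `a` to `τ(a) v`. -/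
noncomputable def equivV (P : CyclicRep n l) : P.R ≃ₗ[ℂ] (Fin l → ℂ) :=
  (Submodule.Quotient.restrictScalarsEquiv ℂ P.annIdeal).symm ≪≫ₗ
    Submodule.quotEquivOfEq _ _ P.ker_evalV.symm ≪≫ₗ
    P.evalV.quotKerEquivOfSurjective P.evalV_surjective

theorem equivV_mk (P : CyclicRep n l) (a : MvPolynomial (Fin n) ℂ) :
    P.equivV (Ideal.Quotient.mk P.annIdeal a) = P.τ a *ᵥ P.v := rfl

theorem v_ne_zero [NeZero l] (P : CyclicRep n l) : P.v ≠ 0 := by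
  intro h
  have h2 := P.cyclic
  simp only [h, Matrix.mulVec_zero] at h2
  have h3 : (fun _ => 1 : Fin l → ℂ) ∈ Submodule.span ℂ
      (Set.range fun _ : Multiplicative (Fin n → ℂ) => (0 : Fin l → ℂ)) := by
    rw [h2]; trivial
  rw [Set.range_const, Submodule.span_zero_singleton, Submodule.mem_bot] at h3
  exact one_ne_zero (congrFun h3 (0 : Fin l))

/-- `R` is a local ring, since the `S_i` act by nilpotent operators. -/
instance isLocalRing [NeZero l] (P : CyclicRep n l) : IsLocalRing P.R := by
  have hnt : Nontrivial P.R := by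
    refine Ideal.Quotient.nontrivial_iff.mpr fun h => P.v_ne_zero ?_
    have h1 : (1 : MvPolynomial (Fin n) ℂ) ∈ P.annIdeal := by rw [h]; trivial
    have h2 : P.τ 1 *ᵥ P.v = 0 := h1
    simpa using h2
  have hS : ∀ i, IsNilpotent (P.S i) := by
    intro i
    obtain ⟨D, hD, -⟩ := P.oneParam_eq_exp i
    refine ⟨D, ?_⟩
    rw [S, ← map_pow, Ideal.Quotient.eq_zero_iff_mem]
    change P.τ _ *ᵥ P.v = 0
    simp [hD]
  have key : ∀ x : P.R, ∃ c : ℂ, IsNilpotent (x - algebraMap ℂ P.R c) := by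
    intro x
    obtain ⟨q, rfl⟩ := Ideal.Quotient.mk_surjective x
    induction q using MvPolynomial.induction_on with
    | C c =>
      refine ⟨c, ?_⟩
      have h0 : Ideal.Quotient.mk P.annIdeal (MvPolynomial.C c) - algebraMap ℂ P.R c = 0 :=
        sub_self _
      rw [h0]
      exact IsNilpotent.zero
    | add p q hp hq =>
      obtain ⟨c, hc⟩ := hp
      obtain ⟨d, hd⟩ := hq
      refine ⟨c + d, ?_⟩
      have := (Commute.all _ _).isNilpotent_add hc hd
      rw [map_add, map_add]
      rwa [add_sub_add_comm]
    | mul_X p i hp =>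
      refine ⟨0, ?_⟩
      rw [map_zero, sub_zero, map_mul]
      exact (Commute.all _ _).isNilpotent_mul_left (hS i)
  refine IsLocalRing.of_isUnit_or_isUnit_one_sub_self fun x => ?_
  obtain ⟨c, hc⟩ := key x
  by_cases h : c = 0
  · right
    subst h
    rw [map_zero, sub_zero] at hc
    exact hc.isUnit_one_sub
  · left
    have hu : IsUnit (algebraMap ℂ P.R c) := (IsUnit.mk0 c h).map _
    have := hc.isUnit_add_left_of_commute hu (Commute.all _ _)
    simpa using this

/-! ### Proper bases and the form `B₀` -/

/-- A basis `μ_1, …, μ_{n+2}` of `R` (indexed from `0`) is proper if `μ_1 = 1`, the vectors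
`μ_2, …, μ_{n+1}` form a basis of `⟨S_1, …, S_n⟩` (that is, they are the images of the generators
after a linear change of the generators), `μ_{n+2}` is a polynomial in the other basis vectors, and
every power of the maximal ideal is spanned by some of the basis vectors. -/
structure IsProperBasis (P : CyclicRep n (n + 2))
    (μ : Module.Basis (Fin (n + 2)) ℂ P.R) : Prop where
  first : μ 0 = 1
  middle : Submodule.span ℂ (Set.range fun i : Fin n => μ i.castSucc.succ) =
    Submodule.span ℂ (Set.range P.S)
  last : μ (Fin.last (n + 1)) ∈ Algebra.adjoin ℂ (μ '' {i | i ≠ Fin.last (n + 1)})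
  powers : ∀ k : ℕ, ∃ J : Set (Fin (n + 2)),
    (IsLocalRing.maximalIdeal P.R ^ k).restrictScalars ℂ = Submodule.span ℂ (μ '' J)

/-- The bilinear form `B₀` on `R` attached to the basis `μ_1, …, μ_{n+2}`:
`B₀(μ_1, μ_i) = -δ_{i,n+2}`, `B₀(μ_i, μ_{n+2}) = -δ_{i1}`, the form is symmetric, and
for `2 ≤ i, j ≤ n + 1` the value `B₀(μ_i, μ_j)` is the coefficient `a_{ij}` of `μ_{n+2}` in
`μ_i μ_j` (when `𝔪² = ⟨μ_{n+2}⟩` this says `μ_i μ_j = a_{ij} μ_{n+2}`). -/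
noncomputable def B₀ (P : CyclicRep n (n + 2)) (μ : Module.Basis (Fin (n + 2)) ℂ P.R) :
    LinearMap.BilinForm ℂ P.R :=
  Matrix.toBilin μ <| Matrix.of fun i j =>
    if i = 0 then (if j = Fin.last (n + 1) then -1 else 0)
    else if j = 0 then (if i = Fin.last (n + 1) then -1 else 0)
    else if i = Fin.last (n + 1) ∨ j = Fin.last (n + 1) then 0
    else μ.repr (μ i * μ j) (Fin.last (n + 1))

/-! ### Orbit closures and quadrics in projective space -/

/-- The orbit `𝔾ₐⁿ⟨v⟩` in `ℙ(ℂˡ)`. -/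
def orbit [NeZero l] (P : CyclicRep n l) : Set (ℙ ℂ (Fin l → ℂ)) :=
  Set.range fun a => Projectivization.mk ℂ ((P.ρ a).1 *ᵥ P.v) fun h =>
    P.v_ne_zero (Matrix.mulVec_injective_of_isUnit (P.ρ a).isUnit
      (h.trans (Matrix.mulVec_zero _).symm))

end CyclicRep

/-- The Zariski closure of a subset of `ℙ(ℂˡ)`: the common zero locus of all homogeneous
polynomials vanishing on the subset. -/
def projZariskiClosure {l : ℕ} (X : Set (ℙ ℂ (Fin l → ℂ))) : Set (ℙ ℂ (Fin l → ℂ)) :=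
  {p | ∀ (d : ℕ) (F : MvPolynomial (Fin l) ℂ), F.IsHomogeneous d →
    (∀ q ∈ X, MvPolynomial.eval q.rep F = 0) → MvPolynomial.eval p.rep F = 0}

/-- A subset of `ℙ(ℂˡ)` is a nondegenerate quadric if it is the zero locus of a nondegenerate
quadratic form. -/
def IsNondegenerateQuadric {l : ℕ} (X : Set (ℙ ℂ (Fin l → ℂ))) : Prop :=
  ∃ q : QuadraticForm ℂ (Fin l → ℂ), q.polarBilin.Nondegenerate ∧ X = {p | q p.rep = 0}

/-! ### The representation as multiplication by exponentials on `R` -/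

namespace CyclicRep

variable {n l : ℕ}

/-! Under `R ≅ ℂˡ` the group acts by multiplication by `exp(∑ aᵢ Sᵢ)` (`ρ_mulVec_equivV`), so the
orbit is the image of `exp(U)`, where `U = ⟨S₁, …, Sₙ⟩`. Faithfulness gives `dim U = n`, while `dim
𝔪 = n + 1`, so `𝔪 = U ⊕ ⟨f⟩` with `f` the last vector of a proper basis. Since `𝔪 = U + 𝔪²`, the
square `𝔪²` is never contained in `U`.

Sufficiency: if `𝔪²` is a line, it is `⟨f⟩`, `𝔪³ = 0`, and `uw = B₀(u,w) f` on `U`. Hence `exp u = 1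
+ u + (B₀(u,u)/2) f`, while `B₀` takes the value `B₀(u,u) - 2cd` on `c + u + d f`. The orbit is
therefore the chart `c ≠ 0` of the quadric `B₀ = 0`, and explicit curves in that chart reach every
point with `c = 0` (`projZariskiClosure_orbit_eq`).

Necessity: a quadric `q = 0` equal to the orbit closure is `ρ`-stable. Differentiating, `β(Sᵢ y, y)`
vanishes wherever `q` does, where `β` is the polar form of `q`. So it is a multiple of `q`
(`eq_smul_of_zeros_subset`), and nilpotency of `Sᵢ` makes the factor zero: every `Sᵢ` is `β`-skew
(`polarBilin_mul_eq_neg`). Moving factors across `β` with signs then forces `dim 𝔪² = 1`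
(`sq_eq_span`) and makes `β` a multiple of `B₀` (`exists_eq_mul_B₀`), so `B₀` is nondegenerate. -/

theorem equivV_one (P : CyclicRep n l) : P.equivV 1 = P.v := by
  have h := P.equivV_mk 1
  rwa [map_one (Ideal.Quotient.mk P.annIdeal), map_one P.τ, Matrix.one_mulVec] at h

theorem equivV_mk_mul (P : CyclicRep n l) (a : MvPolynomial (Fin n) ℂ) (r : P.R) :
    P.equivV (Ideal.Quotient.mk P.annIdeal a * r) = P.τ a *ᵥ P.equivV r := by
  obtain ⟨b, rfl⟩ := Ideal.Quotient.mk_surjective r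
  rw [← map_mul, equivV_mk, equivV_mk, map_mul, Matrix.mulVec_mulVec]

theorem equivV_S_mul (P : CyclicRep n l) (i : Fin n) (r : P.R) :
    P.equivV (P.S i * r) = P.dρ i *ᵥ P.equivV r := by
  rw [S, equivV_mk_mul, τ_X]

theorem equivV_S_pow_mul (P : CyclicRep n l) (i : Fin n) (d : ℕ) (r : P.R) :
    P.equivV (P.S i ^ d * r) = P.dρ i ^ d *ᵥ P.equivV r := by
  rw [S, ← map_pow, equivV_mk_mul, map_pow, τ_X]

theorem S_pow_eq_zero (P : CyclicRep n l) {i : Fin n} {d : ℕ} (h : P.dρ i ^ d = 0) :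
    P.S i ^ d = 0 := by
  apply P.equivV.injective
  have := P.equivV_S_pow_mul i d 1
  rwa [mul_one, h, Matrix.zero_mulVec, ← map_zero P.equivV] at this

theorem isNilpotent_S (P : CyclicRep n l) (i : Fin n) : IsNilpotent (P.S i) := by
  obtain ⟨D, hD, -⟩ := P.oneParam_eq_exp i
  exact ⟨D, P.S_pow_eq_zero hD⟩

theorem isNilpotent_sum_S (P : CyclicRep n l) (a : Fin n → ℂ) (s : Finset (Fin n)) :
    IsNilpotent (∑ i ∈ s, a i • P.S i) :=
  isNilpotent_sum fun i _ => (P.isNilpotent_S i).smul (a i)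

theorem oneParam_mulVec_equivV (P : CyclicRep n l) (i : Fin n) (t : ℂ) (r : P.R) :
    P.oneParam i t *ᵥ P.equivV r = P.equivV (IsNilpotent.exp (t • P.S i) * r) := by
  obtain ⟨D, hD, hexp⟩ := P.oneParam_eq_exp i
  have h0 : (t • P.S i) ^ D = 0 := by rw [smul_pow, P.S_pow_eq_zero hD, smul_zero]
  rw [IsNilpotent.exp_eq_sum h0, hexp, Matrix.sum_mulVec, Finset.sum_mul, map_sum]
  refine Finset.sum_congr rfl fun d _ => ?_
  -- `IsNilpotent.exp` has rational coefficients; they are turned into complex ones.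
  have h1 : ((d.factorial : ℚ)⁻¹ • (t • P.S i) ^ d : P.R) =
      (t ^ d / (d.factorial : ℂ)) • P.S i ^ d := by
    rw [smul_pow, ← algebraMap_smul ℂ ((d.factorial : ℚ)⁻¹), smul_smul]
    congr 1
    simp [div_eq_inv_mul]
  rw [h1, smul_mul_assoc, map_smul, equivV_S_pow_mul, Matrix.smul_mulVec]

/-- Under `R ≅ ℂˡ` the representation acts by multiplication by exponentials. -/
theorem ρ_mulVec_equivV (P : CyclicRep n l) (a : Fin n → ℂ) (r : P.R) :
    (P.ρ (Multiplicative.ofAdd a)).1 *ᵥ P.equivV r =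
      P.equivV (IsNilpotent.exp (∑ i, a i • P.S i) * r) := by
  have hall : ∀ s : Finset (Fin n),
      (P.ρ (Multiplicative.ofAdd (∑ i ∈ s, Pi.single i (a i)))).1 *ᵥ P.equivV r =
        P.equivV (IsNilpotent.exp (∑ i ∈ s, a i • P.S i) * r) := by
    intro s
    induction s using Finset.induction_on with
    | empty => simp
    | insert i s hi ih =>
      rw [Finset.sum_insert hi, Finset.sum_insert hi, ofAdd_add, map_mul, Units.val_mul,
        ← Matrix.mulVec_mulVec, ih]
      change P.oneParam i (a i) *ᵥ _ = _
      rw [oneParam_mulVec_equivV, IsNilpotent.exp_add_of_commute (Commute.all _ _)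
        ((P.isNilpotent_S i).smul _) (P.isNilpotent_sum_S a s), mul_assoc]
  have := hall Finset.univ
  rwa [Finset.univ_sum_single] at this

/-- A relation `∑ cᵢ Sᵢ = 0` makes `ρ(c)` multiplication by `exp 0 = 1`, so `c` lies in the kernel
of `ρ`. -/
theorem linearIndependent_S (P : CyclicRep n l) (hP : P.Faithful) :
    LinearIndependent ℂ P.S := by
  rw [Fintype.linearIndependent_iff]
  intro c hc
  have h1 : P.ρ (Multiplicative.ofAdd c) = P.ρ 1 := by
    rw [map_one]
    refine Units.ext (Matrix.ext_of_mulVec_single fun i => ?_)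
    obtain ⟨r, hr⟩ := P.equivV.surjective (Pi.single i 1)
    rw [← hr, ρ_mulVec_equivV, hc, IsNilpotent.exp_zero, one_mul, Units.val_one,
      Matrix.one_mulVec]
  have h2 : c = 0 := congrArg Multiplicative.toAdd (hP h1)
  exact fun i => congrFun h2 i

/-! ### The maximal ideal and the span of the generators -/

/-- The span `⟨S_1, …, S_n⟩` of the generators in `R`. -/
noncomputable def genSpan (P : CyclicRep n l) : Submodule ℂ P.R :=
  Submodule.span ℂ (Set.range P.S)

theorem mem_genSpan_iff (P : CyclicRep n l) {u : P.R} :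
    u ∈ P.genSpan ↔ ∃ a : Fin n → ℂ, ∑ i, a i • P.S i = u :=
  Submodule.mem_span_range_iff_exists_fun ℂ

theorem finrank_genSpan (P : CyclicRep n l) (hP : P.Faithful) :
    Module.finrank ℂ P.genSpan = n := by
  rw [genSpan, finrank_span_eq_card (P.linearIndependent_S hP), Fintype.card_fin]

theorem finrank_R (P : CyclicRep n l) : Module.finrank ℂ P.R = l := by
  rw [P.equivV.finrank_eq, Module.finrank_fin_fun]

instance finite_R (P : CyclicRep n l) : Module.Finite ℂ P.R :=
  Module.Finite.equiv P.equivV.symm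

theorem exists_sub_mem_span_S (P : CyclicRep n l) (x : P.R) :
    ∃ c : ℂ, x - c • 1 ∈ Ideal.span (Set.range P.S) := by
  obtain ⟨q, rfl⟩ := Ideal.Quotient.mk_surjective x
  induction q using MvPolynomial.induction_on with
  | C c =>
    refine ⟨c, ?_⟩
    have h0 : Ideal.Quotient.mk P.annIdeal (MvPolynomial.C c) - c • (1 : P.R) = 0 := by
      rw [← Algebra.algebraMap_eq_smul_one]
      exact sub_self _
    rw [h0]
    exact Ideal.zero_mem _
  | add p q hp hq =>
    obtain ⟨c, hc⟩ := hp
    obtain ⟨d, hd⟩ := hq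
    refine ⟨c + d, ?_⟩
    rw [map_add, add_smul, add_sub_add_comm]
    exact Ideal.add_mem _ hc hd
  | mul_X p i hp =>
    refine ⟨0, ?_⟩
    rw [zero_smul, sub_zero, map_mul]
    exact Ideal.mul_mem_left _ _ (Ideal.subset_span ⟨i, rfl⟩)

variable [NeZero l]

/-- The maximal ideal of `R` as a complex vector space. -/
noncomputable abbrev maxSub (P : CyclicRep n l) : Submodule ℂ P.R :=
  (IsLocalRing.maximalIdeal P.R).restrictScalars ℂ

theorem mem_maximalIdeal_of_isNilpotent (P : CyclicRep n l) {x : P.R} (h : IsNilpotent x) :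
    x ∈ IsLocalRing.maximalIdeal P.R := by
  rw [IsLocalRing.mem_maximalIdeal]
  exact h.not_isUnit

theorem genSpan_le_maxSub (P : CyclicRep n l) : P.genSpan ≤ P.maxSub := by
  refine Submodule.span_le.mpr ?_
  rintro _ ⟨i, rfl⟩
  exact P.mem_maximalIdeal_of_isNilpotent (P.isNilpotent_S i)

theorem span_S_le (P : CyclicRep n l) :
    Ideal.span (Set.range P.S) ≤ IsLocalRing.maximalIdeal P.R := by
  refine Ideal.span_le.mpr ?_
  rintro _ ⟨i, rfl⟩
  exact P.mem_maximalIdeal_of_isNilpotent (P.isNilpotent_S i)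

theorem smul_one_mem_maximalIdeal (P : CyclicRep n l) {c : ℂ}
    (h : c • (1 : P.R) ∈ IsLocalRing.maximalIdeal P.R) : c = 0 := by
  by_contra hc
  rw [IsLocalRing.mem_maximalIdeal, ← Algebra.algebraMap_eq_smul_one] at h
  exact h ((IsUnit.mk0 c hc).map _)

theorem maximalIdeal_eq_span_S (P : CyclicRep n l) :
    IsLocalRing.maximalIdeal P.R = Ideal.span (Set.range P.S) := by
  refine le_antisymm (fun x hx => ?_) P.span_S_le
  obtain ⟨c, hc⟩ := P.exists_sub_mem_span_S x
  have h1 := Ideal.sub_mem _ hx (P.span_S_le hc)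
  rw [sub_sub_cancel] at h1
  rwa [P.smul_one_mem_maximalIdeal h1, zero_smul, sub_zero] at hc

theorem exists_sub_mem_maximalIdeal (P : CyclicRep n l) (x : P.R) :
    ∃ c : ℂ, x - c • 1 ∈ IsLocalRing.maximalIdeal P.R := by
  rw [maximalIdeal_eq_span_S]
  exact P.exists_sub_mem_span_S x

theorem isCompl_span_one_maxSub (P : CyclicRep n l) :
    IsCompl (Submodule.span ℂ {(1 : P.R)}) P.maxSub := by
  constructor
  · rw [Submodule.disjoint_def]
    intro x hx hm
    obtain ⟨c, rfl⟩ := Submodule.mem_span_singleton.mp hx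
    rw [P.smul_one_mem_maximalIdeal hm, zero_smul]
  · rw [codisjoint_iff, eq_top_iff]
    intro x _
    obtain ⟨c, hc⟩ := P.exists_sub_mem_maximalIdeal x
    exact Submodule.mem_sup.mpr ⟨c • 1, Submodule.mem_span_singleton.mpr ⟨c, rfl⟩, _, hc,
      add_sub_cancel _ _⟩

theorem finrank_maxSub (P : CyclicRep n l) : Module.finrank ℂ P.maxSub + 1 = l := by
  have h := Submodule.finrank_add_eq_of_isCompl P.isCompl_span_one_maxSub
  rw [finrank_span_singleton one_ne_zero, P.finrank_R] at h
  omega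

/-- Split each coefficient of an element of `(S₁, …, Sₙ)` into its constant and its part in `𝔪`. -/
theorem maxSub_le_sup (P : CyclicRep n l) :
    P.maxSub ≤ P.genSpan ⊔ (IsLocalRing.maximalIdeal P.R ^ 2).restrictScalars ℂ := by
  intro x hx
  have hx' : x ∈ IsLocalRing.maximalIdeal P.R := hx
  rw [maximalIdeal_eq_span_S, Ideal.mem_span_range_iff_exists_fun] at hx'
  obtain ⟨c, rfl⟩ := hx'
  refine Submodule.sum_mem _ fun i _ => ?_
  obtain ⟨d, hd⟩ := P.exists_sub_mem_maximalIdeal (c i)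
  have hS : P.S i ∈ P.genSpan := Submodule.subset_span ⟨i, rfl⟩
  have h : c i * P.S i = d • P.S i + (c i - d • 1) * P.S i := by
    rw [sub_mul, smul_mul_assoc, one_mul, add_sub_cancel]
  rw [h]
  refine Submodule.add_mem_sup (Submodule.smul_mem _ _ hS) ?_
  change _ ∈ IsLocalRing.maximalIdeal P.R ^ 2
  rw [pow_two]
  exact Ideal.mul_mem_mul hd (P.genSpan_le_maxSub hS)

theorem exists_maximalIdeal_pow_eq_bot (P : CyclicRep n l) :
    ∃ N : ℕ, IsLocalRing.maximalIdeal P.R ^ N = ⊥ := by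
  have : IsNilpotent (IsLocalRing.maximalIdeal P.R) := by
    rw [Ideal.FG.isNilpotent_iff_le_nilradical (IsNoetherian.noetherian _),
      maximalIdeal_eq_span_S, Ideal.span_le]
    rintro _ ⟨i, rfl⟩
    exact P.isNilpotent_S i
  exact this

theorem isNilpotent_of_mem_maximalIdeal (P : CyclicRep n l) {x : P.R}
    (hx : x ∈ IsLocalRing.maximalIdeal P.R) : IsNilpotent x := by
  obtain ⟨N, hN⟩ := P.exists_maximalIdeal_pow_eq_bot
  exact ⟨N, by simpa [hN] using Ideal.pow_mem_pow hx N⟩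

end CyclicRep

/-! ### Existence of proper bases -/

theorem Fin.eq_zero_or_castSucc_succ_or_last {n : ℕ} (i : Fin (n + 2)) :
    i = 0 ∨ (∃ j : Fin n, i = j.castSucc.succ) ∨ i = Fin.last (n + 1) := by
  refine Fin.cases (Or.inl rfl) (fun i => Or.inr ?_) i
  refine Fin.lastCases (Or.inr rfl) (fun j => Or.inl ⟨j, rfl⟩) i

theorem Fin.castSucc_succ_ne_last {n : ℕ} (i : Fin n) : i.castSucc.succ ≠ Fin.last (n + 1) := by
  intro h
  rw [← Fin.succ_last, Fin.succ_inj] at h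
  exact (Fin.castSucc_lt_last i).ne h

/-- A finite descending chain of subspaces has an adapted basis. -/
theorem exists_linearIndepOn_adapted {K V : Type*} [DivisionRing K] [AddCommGroup V] [Module K V]
    (N : ℕ) : ∀ W : ℕ → Submodule K V, Antitone W → W N = ⊥ →
      ∃ s : Set V, LinearIndepOn K id s ∧ Submodule.span K s = W 0 ∧
        ∀ k, ∃ t ⊆ s, W k = Submodule.span K t := by
  induction N with
  | zero =>
    intro W hW h0
    refine ⟨∅, linearIndepOn_empty K id, by rw [Submodule.span_empty, h0],
      fun k => ⟨∅, subset_rfl, ?_⟩⟩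
    rw [Submodule.span_empty, eq_bot_iff, ← h0]
    exact hW (Nat.zero_le k)
  | succ N ih =>
    intro W hW h0
    -- A basis adapted to the chain from `W 1` on extends to a basis of `W 0`.
    obtain ⟨s, hs, hspan, hsub⟩ := ih (fun k => W (k + 1)) (fun a b h => hW (by omega)) h0
    have hs0 : s ⊆ (W 0 : Set V) := fun x hx =>
      hW (Nat.zero_le 1) (hspan ▸ Submodule.subset_span hx)
    have h1 : Submodule.span K (hs.extend hs0) = W 0 := by
      rw [hs.span_extend_eq_span hs0, Submodule.span_eq]
    refine ⟨hs.extend hs0, hs.linearIndepOn_extend hs0, h1, fun k => ?_⟩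
    cases k with
    | zero => exact ⟨_, subset_rfl, h1.symm⟩
    | succ k =>
      obtain ⟨t, ht, htk⟩ := hsub k
      exact ⟨t, ht.trans (hs.subset_extend hs0), htk⟩

namespace CyclicRep

variable {n l : ℕ}

theorem adjoin_range_S (P : CyclicRep n l) : Algebra.adjoin ℂ (Set.range P.S) = ⊤ := by
  have h := congrArg (Subalgebra.map (Ideal.Quotient.mkₐ ℂ P.annIdeal))
    (MvPolynomial.adjoin_range_X (R := ℂ) (σ := Fin n))
  rw [AlgHom.map_adjoin, ← Set.range_comp, Algebra.map_top,
    (AlgHom.range_eq_top _).mpr (Ideal.Quotient.mkₐ_surjective ℂ P.annIdeal)] at h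
  exact h

/-- Supplies the middle vectors of a proper basis: a basis of `U` adapted to the chain `𝔪ᵏ ∩ U`,
whose term at `k = 0` is `U` itself. -/
theorem exists_adapted_family (P : CyclicRep n l) [NeZero l] (hP : P.Faithful) :
    ∃ w : Fin n → P.R, LinearIndependent ℂ w ∧ Submodule.span ℂ (Set.range w) = P.genSpan ∧
      ∀ k, ∃ T : Set (Fin n), (IsLocalRing.maximalIdeal P.R ^ k).restrictScalars ℂ ⊓ P.genSpan =
        Submodule.span ℂ (w '' T) := by
  obtain ⟨N, hN⟩ := P.exists_maximalIdeal_pow_eq_bot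
  obtain ⟨s, hs, hspan, hsub⟩ := exists_linearIndepOn_adapted N
    (fun k => (IsLocalRing.maximalIdeal P.R ^ k).restrictScalars ℂ ⊓ P.genSpan)
    (fun a b h => inf_le_inf_right _ fun x hx => Ideal.pow_le_pow_right h hx)
    (by simp [hN])
  have hspan' : Submodule.span ℂ s = P.genSpan := by simpa using hspan
  have : Finite s := hs.finite
  have := Fintype.ofFinite s
  have hcard : Fintype.card s = n := by
    have h := finrank_span_set_eq_card hs
    rw [hspan', P.finrank_genSpan hP, Set.toFinset_card] at h
    exact h.symm
  let e : Fin n ≃ s := (Fintype.equivFinOfCardEq hcard).symm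
  refine ⟨fun i => e i, ?_, ?_, fun k => ?_⟩
  · exact LinearIndependent.comp hs e e.injective
  · rw [← hspan']
    congr 1
    ext x
    constructor
    · rintro ⟨i, rfl⟩
      exact (e i).2
    · intro hx
      exact ⟨e.symm ⟨x, hx⟩, by simp⟩
  · obtain ⟨t, ht, htk⟩ := hsub k
    refine ⟨{i | (e i : P.R) ∈ t}, htk.trans ?_⟩
    congr 1
    ext x
    constructor
    · intro hx
      exact ⟨e.symm ⟨x, ht hx⟩, by simpa using hx, by simp⟩
    · rintro ⟨i, hi, rfl⟩
      exact hi

theorem not_maxSub_le_genSpan (P : CyclicRep n (n + 2)) (hP : P.Faithful) :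
    ¬ P.maxSub ≤ P.genSpan := by
  intro h
  have h1 := Submodule.finrank_mono h
  have h2 := P.finrank_maxSub
  rw [P.finrank_genSpan hP] at h1
  omega

theorem genSpan_sup_span_singleton (P : CyclicRep n (n + 2)) (hP : P.Faithful) {e : P.R}
    (he : e ∈ P.maxSub) (he' : e ∉ P.genSpan) :
    P.genSpan ⊔ Submodule.span ℂ {e} = P.maxSub := by
  have hle : P.genSpan ⊔ Submodule.span ℂ {e} ≤ P.maxSub :=
    sup_le P.genSpan_le_maxSub ((Submodule.span_singleton_le_iff_mem _ _).mpr he)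
  refine Submodule.eq_of_le_of_finrank_le hle ?_
  have hlt : P.genSpan < P.genSpan ⊔ Submodule.span ℂ {e} :=
    lt_of_le_of_ne le_sup_left fun h => he' (h ▸
      Submodule.mem_sup_right (Submodule.mem_span_singleton_self e))
  have h1 := Submodule.finrank_lt_finrank_of_lt hlt
  have h2 := P.finrank_maxSub
  rw [P.finrank_genSpan hP] at h1
  omega

/-- Supplies the last vector of a proper basis: `e` is taken from the last power of `𝔪` not
contained in `U`. -/
theorem exists_mem_pow_not_mem_genSpan (P : CyclicRep n (n + 2)) (hP : P.Faithful) :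
    ∃ e ∈ P.maxSub, e ∉ P.genSpan ∧ ∀ k, e ∈ IsLocalRing.maximalIdeal P.R ^ k ∨
      (IsLocalRing.maximalIdeal P.R ^ k).restrictScalars ℂ ≤ P.genSpan := by
  classical
  obtain ⟨N, hN⟩ := P.exists_maximalIdeal_pow_eq_bot
  have hex : ∃ k, (IsLocalRing.maximalIdeal P.R ^ k).restrictScalars ℂ ≤ P.genSpan :=
    ⟨N, by simp [hN]⟩
  -- Neither `𝔪⁰ = R` nor `𝔪¹` lies in `U`, so the power `K` chosen below is at least `1` and `e ∈
  -- 𝔪`.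
  have h1 : 1 < Nat.find hex := by
    rw [Nat.lt_find_iff]
    intro m hm hle
    refine P.not_maxSub_le_genSpan hP (le_trans (fun x hx => ?_) hle)
    have hx' : x ∈ IsLocalRing.maximalIdeal P.R ^ 1 := by rwa [pow_one]
    exact Ideal.pow_le_pow_right hm hx'
  obtain ⟨K, hK⟩ : ∃ K, Nat.find hex = K + 1 := ⟨Nat.find hex - 1, by omega⟩
  have hK' := Nat.find_min hex (m := K) (by omega)
  obtain ⟨e, he, he'⟩ := SetLike.not_le_iff_exists.mp hK'
  have he0 : e ∈ IsLocalRing.maximalIdeal P.R ^ K := he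
  refine ⟨e, ?_, he', fun k => ?_⟩
  · have := Ideal.pow_le_pow_right (show 1 ≤ K by omega) he0
    rwa [pow_one] at this
  · rcases le_or_gt k K with hk | hk
    · exact Or.inl (Ideal.pow_le_pow_right hk he0)
    · refine Or.inr (le_trans (fun x hx => ?_) (Nat.find_spec hex))
      exact Ideal.pow_le_pow_right (show Nat.find hex ≤ k by omega) hx

theorem exists_isProperBasis (P : CyclicRep n (n + 2)) (hP : P.Faithful) :
    ∃ μ : Module.Basis (Fin (n + 2)) ℂ P.R, P.IsProperBasis μ := by
  obtain ⟨w, hw, hspan, hpow⟩ := P.exists_adapted_family hP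
  obtain ⟨e, hem, heU, hek⟩ := P.exists_mem_pow_not_mem_genSpan hP
  have hspan2 : Submodule.span ℂ (Set.range (Fin.snoc w e : Fin (n + 1) → P.R)) = P.maxSub := by
    rw [Fin.range_snoc, Submodule.span_insert, hspan, sup_comm]
    exact P.genSpan_sup_span_singleton hP hem heU
  have hli : LinearIndependent ℂ (Fin.cons 1 (Fin.snoc w e : Fin (n + 1) → P.R) :
      Fin (n + 2) → P.R) := by
    refine linearIndependent_finCons.mpr ⟨linearIndependent_finSnoc.mpr ⟨hw, ?_⟩, ?_⟩
    · rwa [hspan]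
    · rw [hspan2]
      exact fun h => one_ne_zero (P.smul_one_mem_maximalIdeal (c := 1) (by rwa [one_smul]))
  let μ : Module.Basis (Fin (n + 2)) ℂ P.R :=
    basisOfLinearIndependentOfCardEqFinrank hli (by rw [P.finrank_R, Fintype.card_fin])
  have hμ : ∀ i, μ i = (Fin.cons 1 (Fin.snoc w e : Fin (n + 1) → P.R) : Fin (n + 2) → P.R) i :=
    fun i => congrFun (coe_basisOfLinearIndependentOfCardEqFinrank hli _) i
  have hmid : ∀ i : Fin n, μ i.castSucc.succ = w i := fun i => by
    rw [hμ, Fin.cons_succ, Fin.snoc_castSucc]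
  have hlast : μ (Fin.last (n + 1)) = e := by
    rw [hμ, ← Fin.succ_last, Fin.cons_succ, Fin.snoc_last]
  refine ⟨μ, ⟨by rw [hμ, Fin.cons_zero], ?_, ?_, fun k => ?_⟩⟩
  · simp only [hmid]
    exact hspan
  -- The middle vectors already span the algebra generators `Sᵢ`.
  · have htop : Algebra.adjoin ℂ (μ '' {i | i ≠ Fin.last (n + 1)}) = ⊤ := by
      rw [eq_top_iff, ← P.adjoin_range_S, Algebra.adjoin_le_iff]
      rintro _ ⟨i, rfl⟩
      have h1 : P.S i ∈ Submodule.span ℂ (Set.range w) := by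
        rw [hspan]
        exact Submodule.subset_span ⟨i, rfl⟩
      refine Algebra.span_le_adjoin ℂ _ (Submodule.span_mono ?_ h1)
      rintro _ ⟨j, rfl⟩
      exact ⟨_, Fin.castSucc_succ_ne_last j, hmid j⟩
    rw [htop]
    trivial
  · obtain ⟨T, hT⟩ := hpow k
    have himg : μ '' ((fun i : Fin n => i.castSucc.succ) '' T) = w '' T := by
      rw [Set.image_image]
      simp only [hmid]
    rcases hek k with h | h
    -- For `k = 0` the vector `1` is needed as well; for `k ≥ 1` the modular law gives `𝔪ᵏ = ⟨e⟩ ⊕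
    -- (𝔪ᵏ ∩ U)`.
    · rcases Nat.eq_zero_or_pos k with rfl | hk
      · refine ⟨Set.univ, ?_⟩
        rw [Set.image_univ, μ.span_eq, pow_zero, Ideal.one_eq_top, Submodule.restrictScalars_top]
      refine ⟨insert (Fin.last (n + 1)) ((fun i : Fin n => i.castSucc.succ) '' T), ?_⟩
      rw [Set.image_insert_eq, himg, Submodule.span_insert, hlast, ← hT]
      apply le_antisymm
      · intro x hx
        have hx1 : x ∈ P.maxSub := by
          have := Ideal.pow_le_pow_right (I := IsLocalRing.maximalIdeal P.R)
            (show 1 ≤ k from hk) hx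
          rw [pow_one] at this
          exact this
        rw [← P.genSpan_sup_span_singleton hP hem heU] at hx1
        obtain ⟨u, hu, y, hy, rfl⟩ := Submodule.mem_sup.mp hx1
        obtain ⟨c, rfl⟩ := Submodule.mem_span_singleton.mp hy
        rw [add_comm u]
        refine Submodule.add_mem_sup hy ⟨?_, hu⟩
        have hce : c • e ∈ (IsLocalRing.maximalIdeal P.R ^ k).restrictScalars ℂ :=
          Submodule.smul_mem _ c h
        simpa using Submodule.sub_mem _ hx hce
      · exact sup_le ((Submodule.span_singleton_le_iff_mem _ _).mpr h) inf_le_left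
    · refine ⟨(fun i : Fin n => i.castSucc.succ) '' T, ?_⟩
      rw [himg, ← hT, inf_eq_left.mpr h]

end CyclicRep

/-! ### The form `B₀` of a proper basis and the multiplication of `R` -/

namespace CyclicRep

variable {n : ℕ} (P : CyclicRep n (n + 2)) (μ : Module.Basis (Fin (n + 2)) ℂ P.R)

theorem B₀_apply_basis (i j : Fin (n + 2)) : P.B₀ μ (μ i) (μ j) =
    if i = 0 then (if j = Fin.last (n + 1) then -1 else 0)
    else if j = 0 then (if i = Fin.last (n + 1) then -1 else 0)
    else if i = Fin.last (n + 1) ∨ j = Fin.last (n + 1) then 0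
    else μ.repr (μ i * μ j) (Fin.last (n + 1)) := by
  rw [← LinearMap.BilinForm.toMatrix_apply μ, B₀, LinearMap.BilinForm.toMatrix_toBilin,
    Matrix.of_apply]

theorem B₀_isSymm : (P.B₀ μ).IsSymm := by
  rw [LinearMap.BilinForm.isSymm_iff_basis μ]
  intro i j
  simp only [B₀_apply_basis, mul_comm (μ j), or_comm (a := j = Fin.last (n + 1))]
  split_ifs <;> simp_all

theorem B₀_comm (x y : P.R) : P.B₀ μ x y = P.B₀ μ y x := (P.B₀_isSymm μ).eq x y

variable {P μ}

namespace IsProperBasis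

theorem span_middle (hμ : P.IsProperBasis μ) :
    Submodule.span ℂ (Set.range fun i : Fin n => μ i.castSucc.succ) = P.genSpan := hμ.middle

theorem middle_mem (hμ : P.IsProperBasis μ) (i : Fin n) : μ i.castSucc.succ ∈ P.genSpan := by
  rw [← hμ.span_middle]
  exact Submodule.subset_span ⟨i, rfl⟩

/-- A subspace of `𝔪` outside `⟨S_1, …, S_n⟩` that is spanned by some vectors of a proper basis
contains the last vector. -/
theorem last_mem_of_span (hμ : P.IsProperBasis μ) {J : Set (Fin (n + 2))}
    (hm : Submodule.span ℂ (μ '' J) ≤ P.maxSub) (hU : ¬ Submodule.span ℂ (μ '' J) ≤ P.genSpan) :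
    μ (Fin.last (n + 1)) ∈ Submodule.span ℂ (μ '' J) := by
  by_contra hlast
  refine hU (Submodule.span_le.mpr ?_)
  rintro _ ⟨i, hi, rfl⟩
  have hi' : μ i ∈ Submodule.span ℂ (μ '' J) := Submodule.subset_span ⟨i, hi, rfl⟩
  rcases Fin.eq_zero_or_castSucc_succ_or_last i with rfl | ⟨j, rfl⟩ | rfl
  · have h1 : (1 : P.R) ∈ P.maxSub := hμ.first ▸ hm hi'
    exact absurd (P.smul_one_mem_maximalIdeal (c := 1) (by rwa [one_smul])) one_ne_zero
  · exact hμ.middle_mem j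
  · exact absurd hi' hlast

theorem last_mem (hμ : P.IsProperBasis μ) (hP : P.Faithful) :
    μ (Fin.last (n + 1)) ∈ P.maxSub := by
  obtain ⟨J, hJ⟩ := hμ.powers 1
  rw [pow_one] at hJ
  have := hμ.last_mem_of_span hJ.ge (fun h => P.not_maxSub_le_genSpan hP (hJ.le.trans h))
  exact hJ.ge this

theorem last_notMem (hμ : P.IsProperBasis μ) : μ (Fin.last (n + 1)) ∉ P.genSpan := by
  rw [← hμ.span_middle]
  have : (Set.range fun i : Fin n => μ i.castSucc.succ) =
      μ '' (Set.range fun i : Fin n => i.castSucc.succ) := by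
    rw [← Set.range_comp]
    rfl
  rw [this]
  refine μ.linearIndependent.notMem_span_image ?_
  rintro ⟨i, hi⟩
  exact Fin.castSucc_succ_ne_last i hi

theorem exists_decomposition_of_mem (hμ : P.IsProperBasis μ) (hP : P.Faithful) {r : P.R}
    (hr : r ∈ P.maxSub) : ∃ u ∈ P.genSpan, ∃ d : ℂ, r = u + d • μ (Fin.last (n + 1)) := by
  rw [← P.genSpan_sup_span_singleton hP (hμ.last_mem hP) hμ.last_notMem] at hr
  obtain ⟨u, hu, y, hy, rfl⟩ := Submodule.mem_sup.mp hr
  obtain ⟨d, rfl⟩ := Submodule.mem_span_singleton.mp hy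
  exact ⟨u, hu, d, rfl⟩

theorem exists_decomposition (hμ : P.IsProperBasis μ) (hP : P.Faithful) (r : P.R) :
    ∃ c : ℂ, ∃ u ∈ P.genSpan, ∃ d : ℂ, r = c • 1 + u + d • μ (Fin.last (n + 1)) := by
  obtain ⟨c, hc⟩ := P.exists_sub_mem_maximalIdeal r
  obtain ⟨u, hu, d, h⟩ := hμ.exists_decomposition_of_mem hP hc
  exact ⟨c, u, hu, d, by rw [add_assoc, ← h, add_sub_cancel]⟩

theorem B₀_one_one (hμ : P.IsProperBasis μ) : P.B₀ μ 1 1 = 0 := by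
  rw [← hμ.first, B₀_apply_basis, if_pos rfl, if_neg]
  exact (Fin.last_pos).ne

theorem B₀_one_last (hμ : P.IsProperBasis μ) : P.B₀ μ 1 (μ (Fin.last (n + 1))) = -1 := by
  rw [← hμ.first, B₀_apply_basis, if_pos rfl, if_pos rfl]

theorem _root_.CyclicRep.B₀_last_last :
    P.B₀ μ (μ (Fin.last (n + 1))) (μ (Fin.last (n + 1))) = 0 := by
  have h : Fin.last (n + 1) ≠ 0 := (Fin.last_pos).ne'
  rw [B₀_apply_basis, if_neg h, if_neg h, if_pos (Or.inl rfl)]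

theorem B₀_one_gen (hμ : P.IsProperBasis μ) {u : P.R} (hu : u ∈ P.genSpan) :
    P.B₀ μ 1 u = 0 := by
  rw [← hμ.span_middle] at hu
  induction hu using Submodule.span_induction with
  | mem x hx =>
    obtain ⟨i, rfl⟩ := hx
    beta_reduce
    rw [← hμ.first, B₀_apply_basis, if_pos rfl, if_neg (Fin.castSucc_succ_ne_last i)]
  | zero => exact map_zero _
  | add x y _ _ hx hy => rw [map_add, hx, hy, add_zero]
  | smul c x _ hx => rw [map_smul, hx, smul_zero]

theorem B₀_last_gen (hμ : P.IsProperBasis μ) {u : P.R} (hu : u ∈ P.genSpan) :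
    P.B₀ μ (μ (Fin.last (n + 1))) u = 0 := by
  rw [← hμ.span_middle] at hu
  induction hu using Submodule.span_induction with
  | mem x hx =>
    obtain ⟨i, rfl⟩ := hx
    beta_reduce
    rw [B₀_apply_basis, if_neg (Fin.last_pos).ne', if_neg (Fin.succ_ne_zero _),
      if_pos (Or.inl rfl)]
  | zero => exact map_zero _
  | add x y _ _ hx hy => rw [map_add, hx, hy, add_zero]
  | smul c x _ hx => rw [map_smul, hx, smul_zero]

theorem gen_mul_gen (hμ : P.IsProperBasis μ)
    (h2 : (IsLocalRing.maximalIdeal P.R ^ 2).restrictScalars ℂ =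
      Submodule.span ℂ {μ (Fin.last (n + 1))})
    {u w : P.R} (hu : u ∈ P.genSpan) (hw : w ∈ P.genSpan) :
    u * w = P.B₀ μ u w • μ (Fin.last (n + 1)) := by
  rw [← hμ.span_middle] at hu hw
  induction hu using Submodule.span_induction with
  | mem x hx =>
    obtain ⟨i, rfl⟩ := hx
    beta_reduce
    induction hw using Submodule.span_induction with
    | mem y hy =>
      obtain ⟨j, rfl⟩ := hy
      beta_reduce
      have hm : μ i.castSucc.succ * μ j.castSucc.succ ∈
          (IsLocalRing.maximalIdeal P.R ^ 2).restrictScalars ℂ := by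
        change _ ∈ IsLocalRing.maximalIdeal P.R ^ 2
        rw [pow_two]
        exact Ideal.mul_mem_mul (P.genSpan_le_maxSub (hμ.middle_mem i))
          (P.genSpan_le_maxSub (hμ.middle_mem j))
      rw [h2] at hm
      obtain ⟨c, hc⟩ := Submodule.mem_span_singleton.mp hm
      rw [B₀_apply_basis, if_neg (Fin.succ_ne_zero _), if_neg (Fin.succ_ne_zero _), if_neg, ← hc]
      · simp
      · rintro (h | h)
        · exact Fin.castSucc_succ_ne_last _ h
        · exact Fin.castSucc_succ_ne_last _ h
    | zero => simp
    | add x y _ _ hx hy => rw [mul_add, map_add, hx, hy, add_smul]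
    | smul c x _ hx => rw [mul_smul_comm, map_smul, hx, smul_assoc]
  | zero => simp
  | add x y _ _ hx hy => rw [add_mul, map_add, LinearMap.add_apply, hx, hy, add_smul]
  | smul c x _ hx => rw [smul_mul_assoc, map_smul, LinearMap.smul_apply, hx, smul_assoc]

/-- `𝔪²` is spanned by basis vectors, and `𝔪² ≤ U` would give `𝔪 = U + 𝔪² = U`; hence `𝔪²` contains
the last vector. -/
theorem sq_eq_span_last (hμ : P.IsProperBasis μ) (hP : P.Faithful)
    (h : Module.finrank ℂ ↥(IsLocalRing.maximalIdeal P.R ^ 2) = 1) :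
    (IsLocalRing.maximalIdeal P.R ^ 2).restrictScalars ℂ =
      Submodule.span ℂ {μ (Fin.last (n + 1))} := by
  obtain ⟨J, hJ⟩ := hμ.powers 2
  have hm : (IsLocalRing.maximalIdeal P.R ^ 2).restrictScalars ℂ ≤ P.maxSub := fun x hx =>
    Ideal.pow_le_self two_ne_zero hx
  have hmem := hμ.last_mem_of_span (hJ ▸ hm) (fun hle => P.not_maxSub_le_genSpan hP
    (P.maxSub_le_sup.trans (sup_le le_rfl (hJ.le.trans hle))))
  rw [← hJ] at hmem
  refine (Submodule.eq_of_le_of_finrank_le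
    ((Submodule.span_singleton_le_iff_mem _ _).mpr hmem) ?_).symm
  rw [finrank_span_singleton (μ.ne_zero _)]
  exact h.le

/-- With `f` the last vector, the ideal `𝔪² = ⟨f⟩` gives `f x = c f`. If `c ≠ 0`, then `x - c` is a
unit killing `f`, because `x` is nilpotent. -/
theorem _root_.CyclicRep.last_mul_eq_zero
    (h2 : (IsLocalRing.maximalIdeal P.R ^ 2).restrictScalars ℂ =
      Submodule.span ℂ {μ (Fin.last (n + 1))})
    {x : P.R} (hx : x ∈ IsLocalRing.maximalIdeal P.R) : μ (Fin.last (n + 1)) * x = 0 := by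
  have h : μ (Fin.last (n + 1)) * x ∈
      (IsLocalRing.maximalIdeal P.R ^ 2).restrictScalars ℂ :=
    Ideal.mul_mem_right _ _ (h2 ▸ Submodule.mem_span_singleton_self _ :
      μ (Fin.last (n + 1)) ∈ (IsLocalRing.maximalIdeal P.R ^ 2).restrictScalars ℂ)
  rw [h2] at h
  obtain ⟨c, hc⟩ := Submodule.mem_span_singleton.mp h
  by_cases h0 : c = 0
  · rw [← hc, h0, zero_smul]
  · have hu : IsUnit (x - algebraMap ℂ P.R c) :=
      by
      rw [sub_eq_add_neg]
      exact (P.isNilpotent_of_mem_maximalIdeal hx).isUnit_add_right_of_commute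
        ((IsUnit.mk0 c h0).map (algebraMap ℂ P.R)).neg (Commute.all _ _)
    refine absurd ((hu.mul_right_eq_zero (b := μ (Fin.last (n + 1)))).mp ?_) (μ.ne_zero _)
    rw [sub_mul, mul_comm x, ← hc, ← Algebra.smul_def, sub_self]

end IsProperBasis

end CyclicRep

/-! ### Zariski closure and quadrics in projective space -/

theorem MvPolynomial.IsHomogeneous.eval_smul_eq_zero_iff {σ K : Type*} [Field K]
    {F : MvPolynomial σ K} {d : ℕ} (hF : F.IsHomogeneous d) {c : K} (hc : c ≠ 0) (x : σ → K) :
    MvPolynomial.eval (c • x) F = 0 ↔ MvPolynomial.eval x F = 0 := by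
  have h : MvPolynomial.eval (c • x) F = c ^ d * MvPolynomial.eval x F := by
    rw [MvPolynomial.eval_eq, MvPolynomial.eval_eq, Finset.mul_sum]
    refine Finset.sum_congr rfl fun m hm => ?_
    have hd : ∑ i ∈ m.support, m i = d := by
      have := hF (MvPolynomial.mem_support_iff.mp hm)
      rwa [Finsupp.weight_apply, Finsupp.sum, Finset.sum_congr rfl
        (fun i _ => by rw [Pi.one_apply, smul_eq_mul, mul_one])] at this
    rw [← hd, ← Finset.prod_pow_eq_pow_sum]
    simp only [Pi.smul_apply, smul_eq_mul, mul_pow, Finset.prod_mul_distrib]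
    ring
  rw [h, mul_eq_zero, or_iff_right (pow_ne_zero d hc)]

theorem Projectivization.eval_rep_mk_eq_zero_iff {l d : ℕ} {F : MvPolynomial (Fin l) ℂ}
    (hF : F.IsHomogeneous d) {w : Fin l → ℂ} (hw : w ≠ 0) :
    MvPolynomial.eval (Projectivization.mk ℂ w hw).rep F = 0 ↔ MvPolynomial.eval w F = 0 := by
  obtain ⟨a, ha⟩ := Projectivization.exists_smul_eq_mk_rep ℂ w hw
  rw [← ha]
  exact hF.eval_smul_eq_zero_iff a.ne_zero w

theorem QuadraticMap.map_rep_mk_eq_zero_iff {K V : Type*} [Field K] [AddCommGroup V] [Module K V]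
    (q : QuadraticForm K V) {w : V} (hw : w ≠ 0) :
    q (Projectivization.mk K w hw).rep = 0 ↔ q w = 0 := by
  obtain ⟨a, ha⟩ := Projectivization.exists_smul_eq_mk_rep K w hw
  rw [← ha, Units.smul_def, QuadraticMap.map_smul, smul_eq_mul, mul_eq_zero,
    or_iff_right (mul_ne_zero a.ne_zero a.ne_zero)]

theorem QuadraticMap.exists_mvPolynomial {l : ℕ} (q : QuadraticForm ℂ (Fin l → ℂ)) :
    ∃ F : MvPolynomial (Fin l) ℂ, F.IsHomogeneous 2 ∧ ∀ w, MvPolynomial.eval w F = q w := by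
  obtain ⟨B, hB⟩ : ∃ B : LinearMap.BilinForm ℂ (Fin l → ℂ), ∀ w, B w w = q w :=
    ⟨QuadraticMap.associated q, QuadraticMap.associated_eq_self_apply ℂ q⟩
  refine ⟨∑ i, ∑ j, MvPolynomial.C (B (Pi.single i 1) (Pi.single j 1)) *
    (MvPolynomial.X i * MvPolynomial.X j), ?_, fun w => ?_⟩
  · refine MvPolynomial.IsHomogeneous.sum _ _ _ fun i _ =>
      MvPolynomial.IsHomogeneous.sum _ _ _ fun j _ => ?_
    exact ((MvPolynomial.isHomogeneous_X ℂ i).mul (MvPolynomial.isHomogeneous_X ℂ j)).C_mul _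
  · have hw : ∑ i, w i • (Pi.single i 1 : Fin l → ℂ) = w := by
      simpa using (Pi.basisFun ℂ (Fin l)).sum_repr w
    have hBw : B w w = ∑ i, ∑ j, w i * (w j * B (Pi.single i 1) (Pi.single j 1)) := by
      calc B w w = B (∑ i, w i • Pi.single i 1) (∑ j, w j • Pi.single j 1) := by rw [hw]
        _ = _ := by
          rw [LinearMap.map_sum₂]
          refine Finset.sum_congr rfl fun i _ => ?_
          rw [map_sum]
          refine Finset.sum_congr rfl fun j _ => ?_
          rw [map_smul, map_smul, LinearMap.smul_apply, smul_eq_mul, smul_eq_mul]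
          ring
    rw [← hB, hBw]
    simp only [map_sum, map_mul, MvPolynomial.eval_C, MvPolynomial.eval_X]
    exact Finset.sum_congr rfl fun i _ => Finset.sum_congr rfl fun j _ => by ring

theorem subset_projZariskiClosure {l : ℕ} (X : Set (ℙ ℂ (Fin l → ℂ))) :
    X ⊆ projZariskiClosure X := fun _ hp _ _ _ hX => hX _ hp

theorem projZariskiClosure_subset_quadric {l : ℕ} {X : Set (ℙ ℂ (Fin l → ℂ))}
    (q : QuadraticForm ℂ (Fin l → ℂ)) (hX : ∀ p ∈ X, q p.rep = 0) :
    projZariskiClosure X ⊆ {p | q p.rep = 0} := by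
  intro p hp
  obtain ⟨F, hF, hFq⟩ := q.exists_mvPolynomial
  rw [Set.mem_ofPred_eq, ← hFq]
  exact hp 2 F hF fun x hx => by rw [hFq, hX x hx]

/-- A point that is a limit of a continuous curve whose other points lie in `X` lies in the
Zariski closure of `X`. -/
theorem mem_projZariskiClosure_of_curve {l : ℕ} {X : Set (ℙ ℂ (Fin l → ℂ))}
    {γ : ℂ → Fin l → ℂ} (hγ : Continuous γ)
    (hX : ∀ s, s ≠ 0 → ∃ h : γ s ≠ 0, Projectivization.mk ℂ (γ s) h ∈ X) (h0 : γ 0 ≠ 0) :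
    Projectivization.mk ℂ (γ 0) h0 ∈ projZariskiClosure X := by
  intro d F hF hFX
  rw [Projectivization.eval_rep_mk_eq_zero_iff hF]
  have hcont : Continuous fun s => MvPolynomial.eval (γ s) F :=
    (MvPolynomial.continuous_eval F).comp hγ
  -- A continuous function vanishing off `0` vanishes at `0`, since `ℂ ∖ {0}` is dense.
  have heq : (fun s => MvPolynomial.eval (γ s) F) = fun _ => 0 := by
    refine hcont.ext_on (dense_compl_singleton (0 : ℂ)) continuous_const fun s hs => ?_
    obtain ⟨h, hs'⟩ := hX s hs
    exact (Projectivization.eval_rep_mk_eq_zero_iff hF h).mp (hFX _ hs')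
  exact congrFun heq 0

namespace CyclicRep

variable {n l : ℕ}

theorem orbit_subset_iff [NeZero l] (P : CyclicRep n l) (q : QuadraticForm ℂ (Fin l → ℂ)) :
    (∀ p ∈ P.orbit, q p.rep = 0) ↔
      ∀ a : Fin n → ℂ, q (P.equivV (IsNilpotent.exp (∑ i, a i • P.S i))) = 0 := by
  have key : ∀ a : Fin n → ℂ, (P.ρ (Multiplicative.ofAdd a)).1 *ᵥ P.v =
      P.equivV (IsNilpotent.exp (∑ i, a i • P.S i)) := fun a => by
    rw [← P.equivV_one, ρ_mulVec_equivV, mul_one]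
  constructor
  · intro h a
    have := h _ ⟨Multiplicative.ofAdd a, rfl⟩
    rwa [QuadraticMap.map_rep_mk_eq_zero_iff, key] at this
  · rintro h _ ⟨a, rfl⟩
    rw [QuadraticMap.map_rep_mk_eq_zero_iff]
    have := key a.toAdd
    rw [ofAdd_toAdd] at this
    rw [this]
    exact h _

theorem mk_mem_orbit [NeZero l] (P : CyclicRep n l) (a : Fin n → ℂ) {w : Fin l → ℂ} (hw : w ≠ 0)
    {c : ℂ} (hc : c ≠ 0) (h : w = c • P.equivV (IsNilpotent.exp (∑ i, a i • P.S i))) :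
    Projectivization.mk ℂ w hw ∈ P.orbit := by
  refine ⟨Multiplicative.ofAdd a, ?_⟩
  rw [Projectivization.mk_eq_mk_iff']
  refine ⟨c⁻¹, ?_⟩
  rw [h, smul_smul, inv_mul_cancel₀ hc, one_smul, ← P.equivV_one, ρ_mulVec_equivV, mul_one]

end CyclicRep

/-! ### Sufficiency: the orbit closure is the quadric `B₀ = 0` -/

namespace CyclicRep

variable {n : ℕ} {P : CyclicRep n (n + 2)} {μ : Module.Basis (Fin (n + 2)) ℂ P.R}

variable (P μ) in
/-- The quadratic form `B₀(u, u)` in the coordinates of `R ≅ ℂⁿ⁺²`. -/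
noncomputable def quad : QuadraticForm ℂ (Fin (n + 2) → ℂ) :=
  (P.B₀ μ).toQuadraticMap.comp P.equivV.symm.toLinearMap

theorem quad_apply (w : Fin (n + 2) → ℂ) :
    P.quad μ w = P.B₀ μ (P.equivV.symm w) (P.equivV.symm w) := rfl

theorem quad_equivV (r : P.R) : P.quad μ (P.equivV r) = P.B₀ μ r r := by
  rw [quad_apply, LinearEquiv.symm_apply_apply]

theorem polarBilin_quad (x y : Fin (n + 2) → ℂ) :
    (P.quad μ).polarBilin x y = 2 * P.B₀ μ (P.equivV.symm x) (P.equivV.symm y) := by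
  rw [QuadraticMap.polarBilin_apply_apply, QuadraticMap.polar]
  simp only [quad_apply, map_add, LinearMap.add_apply]
  rw [P.B₀_comm μ (P.equivV.symm y)]
  ring

theorem nondegenerate_polarBilin_quad (h : (P.B₀ μ).Nondegenerate) :
    (P.quad μ).polarBilin.Nondegenerate := by
  constructor
  · intro x hx
    refine (LinearEquiv.map_eq_zero_iff P.equivV.symm).mp (h.1 _ fun r => ?_)
    have := hx (P.equivV r)
    rw [polarBilin_quad, LinearEquiv.symm_apply_apply] at this
    exact (mul_eq_zero.mp this).resolve_left two_ne_zero
  · intro x hx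
    refine (LinearEquiv.map_eq_zero_iff P.equivV.symm).mp (h.2 _ fun r => ?_)
    have := hx (P.equivV r)
    rw [polarBilin_quad, LinearEquiv.symm_apply_apply] at this
    exact (mul_eq_zero.mp this).resolve_left two_ne_zero

namespace IsProperBasis

/-- For `B₀`, the space `R` is the orthogonal sum of `U` and the hyperbolic plane spanned by `1` and
the last vector. -/
theorem B₀_decomposition (hμ : P.IsProperBasis μ) {u u' : P.R} (hu : u ∈ P.genSpan)
    (hu' : u' ∈ P.genSpan) (c d c' d' : ℂ) :
    P.B₀ μ (c • 1 + u + d • μ (Fin.last (n + 1))) (c' • 1 + u' + d' • μ (Fin.last (n + 1))) =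
      P.B₀ μ u u' - c * d' - d * c' := by
  simp only [map_add, map_smul, LinearMap.add_apply, LinearMap.smul_apply, smul_eq_mul,
    hμ.B₀_one_one, hμ.B₀_one_last, P.B₀_last_last, hμ.B₀_one_gen hu', hμ.B₀_last_gen hu',
    P.B₀_comm μ u, P.B₀_comm μ (μ (Fin.last (n + 1))) 1, hμ.B₀_one_gen hu, hμ.B₀_last_gen hu]
  ring

theorem exp_gen (hμ : P.IsProperBasis μ)
    (h2 : (IsLocalRing.maximalIdeal P.R ^ 2).restrictScalars ℂ =
      Submodule.span ℂ {μ (Fin.last (n + 1))}) {u : P.R} (hu : u ∈ P.genSpan) :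
    IsNilpotent.exp u = 1 + u + (P.B₀ μ u u / 2) • μ (Fin.last (n + 1)) := by
  have hsq : u ^ 2 = P.B₀ μ u u • μ (Fin.last (n + 1)) := by
    rw [pow_two, hμ.gen_mul_gen h2 hu hu]
  have hcube : u ^ 3 = 0 := by
    rw [pow_succ, hsq, smul_mul_assoc, P.last_mul_eq_zero h2 (P.genSpan_le_maxSub hu), smul_zero]
  rw [IsNilpotent.exp_eq_sum hcube]
  simp only [Finset.sum_range_succ, Finset.sum_range_zero, hsq]
  rw [← algebraMap_smul ℂ (((Nat.factorial 2 : ℕ) : ℚ)⁻¹), smul_smul]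
  simp [div_eq_inv_mul]

theorem orbit_quad_eq_zero (hμ : P.IsProperBasis μ)
    (h2 : (IsLocalRing.maximalIdeal P.R ^ 2).restrictScalars ℂ =
      Submodule.span ℂ {μ (Fin.last (n + 1))}) :
    ∀ p ∈ P.orbit, P.quad μ p.rep = 0 := by
  rw [orbit_subset_iff]
  intro a
  have hu : ∑ i, a i • P.S i ∈ P.genSpan := P.mem_genSpan_iff.mpr ⟨a, rfl⟩
  rw [quad_equivV, hμ.exp_gen h2 hu]
  have := hμ.B₀_decomposition hu hu 1 (P.B₀ μ (∑ i, a i • P.S i) (∑ i, a i • P.S i) / 2)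
    1 (P.B₀ μ (∑ i, a i • P.S i) (∑ i, a i • P.S i) / 2)
  rw [one_smul] at this
  rw [this]
  ring

/-- The points of the quadric with nonzero first coordinate lie on the orbit. -/
theorem mk_mem_orbit (hμ : P.IsProperBasis μ)
    (h2 : (IsLocalRing.maximalIdeal P.R ^ 2).restrictScalars ℂ =
      Submodule.span ℂ {μ (Fin.last (n + 1))}) {u : P.R} (hu : u ∈ P.genSpan) {c d : ℂ}
    (hc : c ≠ 0) (hB : P.B₀ μ u u = 2 * c * d) :
    ∃ h : P.equivV (c • 1 + u + d • μ (Fin.last (n + 1))) ≠ 0,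
      Projectivization.mk ℂ _ h ∈ P.orbit := by
  have hu' : c⁻¹ • u ∈ P.genSpan := Submodule.smul_mem _ _ hu
  obtain ⟨a, ha⟩ := P.mem_genSpan_iff.mp hu'
  -- The last coordinate of `c exp(u/c)` is `B₀(u,u)/(2c)`, which is `d` by the equation of the
  -- quadric.
  have hexp : c • 1 + u + d • μ (Fin.last (n + 1)) = c • IsNilpotent.exp (c⁻¹ • u) := by
    rw [hμ.exp_gen h2 hu', smul_add, smul_add, smul_smul, smul_smul, mul_inv_cancel₀ hc, one_smul]
    congr 2
    simp only [map_smul, LinearMap.smul_apply, smul_eq_mul, hB]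
    field_simp
  have hne : c • (1 : P.R) + u + d • μ (Fin.last (n + 1)) ≠ 0 := by
    rw [hexp, smul_ne_zero_iff_right hc]
    exact (IsNilpotent.isUnit_exp
      (P.isNilpotent_of_mem_maximalIdeal (P.genSpan_le_maxSub hu'))).ne_zero
  refine ⟨fun h => hne (P.equivV.map_eq_zero_iff.mp h), ?_⟩
  refine P.mk_mem_orbit a _ hc ?_
  rw [ha, hexp, map_smul]

/-- Otherwise polarization kills all products of generators, so `𝔪² = 0`. -/
theorem exists_B₀_self_ne_zero (hμ : P.IsProperBasis μ)
    (h2 : (IsLocalRing.maximalIdeal P.R ^ 2).restrictScalars ℂ =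
      Submodule.span ℂ {μ (Fin.last (n + 1))}) :
    ∃ w ∈ P.genSpan, P.B₀ μ w w ≠ 0 := by
  by_contra! hall
  have hzero : ∀ u ∈ P.genSpan, ∀ w ∈ P.genSpan, u * w = 0 := by
    intro u hu w hw
    have h := hall _ (Submodule.add_mem _ hu hw)
    simp only [map_add, LinearMap.add_apply, hall u hu, hall w hw, P.B₀_comm μ w u] at h
    have h' : P.B₀ μ u w = 0 := by linear_combination h / 2
    rw [hμ.gen_mul_gen h2 hu hw, h', zero_smul]
  have hbot : IsLocalRing.maximalIdeal P.R ^ 2 = ⊥ := by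
    rw [pow_two, maximalIdeal_eq_span_S, Ideal.span_mul_span', eq_bot_iff, Ideal.span_le]
    rintro _ ⟨_, ⟨i, rfl⟩, _, ⟨j, rfl⟩, rfl⟩
    exact hzero _ (Submodule.subset_span ⟨i, rfl⟩) _ (Submodule.subset_span ⟨j, rfl⟩)
  have hmem : μ (Fin.last (n + 1)) ∈
      (IsLocalRing.maximalIdeal P.R ^ 2).restrictScalars ℂ :=
    h2 ▸ Submodule.mem_span_singleton_self _
  rw [hbot] at hmem
  exact μ.ne_zero _ hmem

/-- `B₀` stays nondegenerate on `U`: vectors of `U` are already orthogonal to `1` and to the last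
vector. -/
theorem exists_B₀_eq (hμ : P.IsProperBasis μ) (hP : P.Faithful) (hB : (P.B₀ μ).Nondegenerate)
    {u : P.R} (hu : u ∈ P.genSpan) (hu0 : u ≠ 0) (c : ℂ) :
    ∃ w ∈ P.genSpan, P.B₀ μ u w = c := by
  obtain ⟨w, hw, hne⟩ : ∃ w ∈ P.genSpan, P.B₀ μ u w ≠ 0 := by
    by_contra! hall
    refine hu0 (hB.1 u fun r => ?_)
    obtain ⟨c, w, hw, d, rfl⟩ := hμ.exists_decomposition hP r
    have := hμ.B₀_decomposition hu hw 0 0 c d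
    simpa [hall w hw] using this
  refine ⟨(c / P.B₀ μ u w) • w, Submodule.smul_mem _ _ hw, ?_⟩
  rw [map_smul, smul_eq_mul, div_mul_cancel₀ _ hne]

theorem mk_mem_closure_of_curve (hμ : P.IsProperBasis μ)
    (h2 : (IsLocalRing.maximalIdeal P.R ^ 2).restrictScalars ℂ =
      Submodule.span ℂ {μ (Fin.last (n + 1))}) {c d : ℂ → ℂ} (hc : Continuous c)
    (hd : Continuous d) {u w : P.R} (hu : u ∈ P.genSpan) (hw : w ∈ P.genSpan)
    (hc0 : ∀ s, s ≠ 0 → c s ≠ 0)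
    (hB : ∀ s, P.B₀ μ (u + s • w) (u + s • w) = 2 * c s * d s)
    (h0 : P.equivV (c 0 • 1 + (u + (0 : ℂ) • w) + d 0 • μ (Fin.last (n + 1))) ≠ 0) :
    Projectivization.mk ℂ _ h0 ∈ projZariskiClosure P.orbit := by
  refine mem_projZariskiClosure_of_curve
    (γ := fun s => P.equivV (c s • 1 + (u + s • w) + d s • μ (Fin.last (n + 1)))) ?_ ?_ h0
  · simp only [map_add, map_smul]
    fun_prop
  · intro s hs
    exact hμ.mk_mem_orbit h2 (Submodule.add_mem _ hu (Submodule.smul_mem _ _ hw)) (hc0 s hs) (hB s)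

theorem projZariskiClosure_orbit_eq (hμ : P.IsProperBasis μ) (hP : P.Faithful)
    (h1 : Module.finrank ℂ ↥(IsLocalRing.maximalIdeal P.R ^ 2) = 1)
    (hB : (P.B₀ μ).Nondegenerate) :
    projZariskiClosure P.orbit = {p | P.quad μ p.rep = 0} := by
  have h2 := hμ.sq_eq_span_last hP h1
  refine Set.Subset.antisymm
    (projZariskiClosure_subset_quadric _ (hμ.orbit_quad_eq_zero h2)) ?_
  intro p
  induction p using Projectivization.ind with | _ w hw
  rw [Set.mem_ofPred_eq, QuadraticMap.map_rep_mk_eq_zero_iff]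
  obtain ⟨r, rfl⟩ := P.equivV.surjective w
  obtain ⟨c, u, hu, d, rfl⟩ := hμ.exists_decomposition hP r
  rw [quad_equivV, hμ.B₀_decomposition hu hu]
  intro hq
  by_cases hc : c = 0
  · subst hc
    have hq' : P.B₀ μ u u = 0 := by linear_combination hq
    by_cases hu0 : u = 0
    · subst hu0
      obtain ⟨w, hw', hne⟩ := hμ.exists_B₀_self_ne_zero h2
      have hd : d ≠ 0 := by
        rintro rfl
        simp at hw
      -- The point is `⟨f⟩`. Along `s w + d f` the first coordinate solves `s² B₀(w,w) = 2cd`.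
      have := hμ.mk_mem_closure_of_curve h2 (c := fun s => (P.B₀ μ w w / (2 * d)) * s ^ 2)
        (d := fun _ => d) (by fun_prop) (by fun_prop) (Submodule.zero_mem _) hw'
        (fun s hs => mul_ne_zero (div_ne_zero hne (mul_ne_zero two_ne_zero hd)) (pow_ne_zero 2 hs))
        (fun s => by
          simp only [zero_add, map_smul, LinearMap.smul_apply, smul_eq_mul]
          field_simp)
        (by simpa using hw)
      simpa using this
    -- With first coordinate `s`, the quadric requires `2s B₀(u,w) + s² B₀(w,w) = 2s d(s)`; `B₀(u,w)
    -- = d` makes `d(0) = d`.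
    · obtain ⟨w, hw', hwd⟩ := hμ.exists_B₀_eq hP hB hu hu0 d
      have := hμ.mk_mem_closure_of_curve h2 (c := fun s => s)
        (d := fun s => d + s * (P.B₀ μ w w / 2)) (by fun_prop) (by fun_prop) hu hw'
        (fun s hs => hs)
        (fun s => by
          simp only [map_add, map_smul, LinearMap.add_apply, LinearMap.smul_apply, smul_eq_mul,
            hq', hwd, P.B₀_comm μ w u]
          ring)
        (by simpa using hw)
      simpa using this
  · obtain ⟨_, h⟩ := hμ.mk_mem_orbit h2 hu hc (d := d) (by linear_combination hq)
    exact subset_projZariskiClosure _ h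

end IsProperBasis

end CyclicRep

/-! ### Quadratic forms vanishing on a nondegenerate quadric -/

theorem LinearMap.exists_eq_mul_of_ker_le {K V : Type*} [Field K] [AddCommGroup V] [Module K V]
    {f g : V →ₗ[K] K} {z : V} (hz : f z ≠ 0) (h : ∀ y, f y = 0 → g y = 0) (y : V) :
    g y = g z / f z * f y := by
  have h1 := h (y - (f y / f z) • z) (by
    rw [map_sub, map_smul, smul_eq_mul, div_mul_cancel₀ _ hz, sub_self])
  rw [map_sub, map_smul, smul_eq_mul, sub_eq_zero] at h1
  rw [h1]
  ring

namespace QuadraticMap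

variable {V : Type*} [AddCommGroup V] [Module ℂ V]

theorem map_add_smul (q : QuadraticForm ℂ V) (y z : V) (s : ℂ) :
    q (y + s • z) = q y + s * q.polarBilin y z + s ^ 2 * q z := by
  have h : q.polarBilin y (s • z) = q (y + s • z) - q y - q (s • z) := rfl
  rw [map_smul, QuadraticMap.map_smul, smul_eq_mul, smul_eq_mul] at h
  linear_combination -h

theorem polarBilin_comm (q : QuadraticForm ℂ V) (x y : V) :
    q.polarBilin x y = q.polarBilin y x := polar_comm q x y

/-- In dimension at least three an isotropic vector is orthogonal to an anisotropic one. -/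
theorem exists_orthogonal_anisotropic [FiniteDimensional ℂ V] (q : QuadraticForm ℂ V)
    (hq : q.polarBilin.Nondegenerate) (hV : 3 ≤ Module.finrank ℂ V) {x : V} (hx : x ≠ 0) :
    ∃ z, q.polarBilin x z = 0 ∧ q z ≠ 0 := by
  by_contra! hall
  obtain ⟨z, hz⟩ : ∃ z, q.polarBilin x z ≠ 0 := by
    by_contra! h
    exact hx (hq.1 x h)
  -- If `q` vanishes on `x^⊥`, so does its polar form.
  have hpol : ∀ y, q.polarBilin x y = 0 → ∀ z, q.polarBilin x z = 0 → q.polarBilin y z = 0 := by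
    intro y hy z hz
    have h := q.map_add_smul y z 1
    rw [one_smul, hall y hy, hall z hz, hall (y + z) (by rw [map_add, hy, hz, add_zero])] at h
    linear_combination -h
  have hnle : ¬ LinearMap.ker (q.polarBilin x) ≤ Submodule.span ℂ {x} := by
    intro hle
    have h1 := Submodule.finrank_mono hle
    have h2 := (q.polarBilin x).finrank_range_add_finrank_ker
    have h3 : Module.finrank ℂ (LinearMap.range (q.polarBilin x)) ≤ 1 :=
      (Submodule.finrank_le _).trans (by rw [Module.finrank_self])
    rw [finrank_span_singleton hx] at h1
    omega
  obtain ⟨y, hy, hyx⟩ := SetLike.not_le_iff_exists.mp hnle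
  -- The functional of `y` vanishes on `x^⊥`, so it is a multiple of that of `x`; nondegeneracy puts
  -- `y` in `⟨x⟩`.
  have hprop := LinearMap.exists_eq_mul_of_ker_le hz (hpol y hy)
  refine hyx (Submodule.mem_span_singleton.mpr
    ⟨q.polarBilin y z / q.polarBilin x z, (sub_eq_zero.mp (hq.1 _ fun w => ?_)).symm⟩)
  rw [map_sub, map_smul, LinearMap.sub_apply, LinearMap.smul_apply, smul_eq_mul, hprop w, sub_self]

/-- A quadratic form vanishing on a nondegenerate quadric of dimension at least one is a multiple
of its equation. -/
theorem eq_smul_of_zeros_subset [FiniteDimensional ℂ V] (q q' : QuadraticForm ℂ V)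
    (hq : q.polarBilin.Nondegenerate) (hV : 3 ≤ Module.finrank ℂ V)
    (hsub : ∀ y, q y = 0 → q' y = 0) {x : V} (hx : x ≠ 0) (hqx : q x = 0) :
    ∃ c : ℂ, ∀ y, q' y = c * q y := by
  obtain ⟨z, hz⟩ : ∃ z, q.polarBilin x z ≠ 0 := by
    by_contra! h
    exact hx (hq.1 x h)
  -- The line through `y` in the direction `x` meets the quadric at `y - (q y / β(x,y)) x`, where
  -- `β` is the polar form of `q`; there `q'` vanishes too.
  have hgen : ∀ y, q.polarBilin x y ≠ 0 →
      q' y * q.polarBilin x y = q y * q'.polarBilin x y := by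
    intro y hy
    have h := q'.map_add_smul y x (-(q y) / q.polarBilin x y)
    rw [hsub _ (by
      rw [q.map_add_smul, hqx, q.polarBilin_comm y x]
      field_simp
      ring), hsub x hqx, q'.polarBilin_comm y x] at h
    field_simp at h
    refine mul_left_cancel₀ hy ?_
    linear_combination -h
  have hline : ∀ y, q.polarBilin x y = 0 → ∀ s : ℂ, s ≠ 0 → q.polarBilin x (y + s • z) ≠ 0 := by
    intro y hy s hs
    rw [map_add, map_smul, hy, zero_add]
    exact mul_ne_zero hs hz
  -- The identity `hgen` along `y + s z` is a cubic in `s`; its values at `±1, ±2` determine the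
  -- constant term.
  have hall : ∀ y, q.polarBilin x y = 0 → q y * q'.polarBilin x y = 0 := by
    intro y hy
    have h1 := hgen _ (hline y hy 1 one_ne_zero)
    have h2 := hgen _ (hline y hy (-1) (by norm_num))
    have h3 := hgen _ (hline y hy 2 (by norm_num))
    have h4 := hgen _ (hline y hy (-2) (by norm_num))
    simp only [map_add_smul, map_add, map_smul, hy, smul_eq_mul] at h1 h2 h3 h4
    linear_combination -(2 / 3 : ℂ) * (h1 + h2) + (1 / 6 : ℂ) * (h3 + h4)
  have hker : ∀ y, q.polarBilin x y = 0 → q'.polarBilin x y = 0 := by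
    intro y hy
    by_cases hqy : q y = 0
    -- If `q y = 0`, perturb by an anisotropic `w ∈ x^⊥`: adding the identities at `y ± w` leaves `2
    -- q(w)` times the wanted value.
    · obtain ⟨w, hw, hqw⟩ := q.exists_orthogonal_anisotropic hq hV hx
      have hw' := (mul_eq_zero.mp (hall w hw)).resolve_left hqw
      have h1 := hall (y + (1 : ℂ) • w) (by rw [map_add, map_smul, hy, hw, smul_zero, add_zero])
      have h2 := hall (y + (-1 : ℂ) • w) (by rw [map_add, map_smul, hy, hw, smul_zero, add_zero])
      simp only [map_add_smul, map_add, map_smul, hqy, hw', smul_eq_mul] at h1 h2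
      have h3 : q w * q'.polarBilin x y = 0 := by linear_combination (h1 + h2) / 2
      exact (mul_eq_zero.mp h3).resolve_left hqw
    · exact (mul_eq_zero.mp (hall y hy)).resolve_left hqy
  have hprop := LinearMap.exists_eq_mul_of_ker_le hz hker
  refine ⟨q'.polarBilin x z / q.polarBilin x z, fun y => ?_⟩
  set c := q'.polarBilin x z / q.polarBilin x z
  have hgen' : ∀ y, q.polarBilin x y ≠ 0 → q' y = c * q y := by
    intro y hy
    have h := hgen y hy
    rw [hprop y] at h
    refine mul_right_cancel₀ hy ?_
    rw [h]
    ring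
  by_cases hy : q.polarBilin x y = 0
  -- `q' - c q` along `y + s z` is quadratic in `s` and vanishes at `1, -1, 2`, hence also at `0`.
  · have h1 := hgen' _ (hline y hy 1 one_ne_zero)
    have h2 := hgen' _ (hline y hy (-1) (by norm_num))
    have h3 := hgen' _ (hline y hy 2 (by norm_num))
    simp only [map_add_smul] at h1 h2 h3
    linear_combination h1 + (1 / 3 : ℂ) * h2 - (1 / 3 : ℂ) * h3
  · exact hgen' y hy

/-- If multiplication by a nilpotent element `u` preserves the quadric infinitesimally, then it is
skew with respect to the polar form. -/
theorem polarBilin_mul_eq_neg {A : Type*} [CommRing A] [Nontrivial A] [Algebra ℂ A]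
    [FiniteDimensional ℂ A] (q : QuadraticForm ℂ A) (hq : q.polarBilin.Nondegenerate)
    (hA : 3 ≤ Module.finrank ℂ A) (h1 : q 1 = 0) {u : A} (hu : IsNilpotent u)
    (hsub : ∀ y, q y = 0 → q.polarBilin (u * y) y = 0) (x y : A) :
    q.polarBilin (u * x) y = -q.polarBilin x (u * y) := by
  obtain ⟨c, hc⟩ := q.eq_smul_of_zeros_subset
    (LinearMap.BilinMap.toQuadraticMap (q.polarBilin ∘ₗ LinearMap.mulLeft ℂ u)) hq hA hsub
    one_ne_zero h1
  have hc' : ∀ y, q.polarBilin (u * y) y = c * q y := hc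
  have hskew : ∀ x y, q.polarBilin (u * x) y = q.polarBilin x ((c • 1 - u) * y) := by
    intro x y
    -- Polarization shows that the adjoint of `u` is `c - u`.
    have h := hc' (x + (1 : ℂ) • y)
    rw [q.map_add_smul, one_smul, mul_add] at h
    simp only [map_add, LinearMap.add_apply, hc'] at h
    rw [sub_mul, smul_mul_assoc, one_mul, map_sub, map_smul, smul_eq_mul,
      q.polarBilin_comm x (u * y)]
    linear_combination h
  have hpow : ∀ (k : ℕ) (x y : A),
      q.polarBilin (u ^ k * x) y = q.polarBilin x ((c • 1 - u) ^ k * y) := by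
    intro k
    induction k with
    | zero => intro x y; simp
    | succ k ih => intro x y; rw [pow_succ, mul_assoc, ih, hskew, ← mul_assoc, ← pow_succ']
  -- The adjoint of a nilpotent is nilpotent, so `c = (c - u) + u` is nilpotent.
  have hc0 : c = 0 := by
    obtain ⟨k, hk⟩ := hu
    have hnil : IsNilpotent (c • (1 : A) - u) := ⟨k, hq.2 _ fun x => by
      have := hpow k x 1
      rwa [hk, zero_mul, map_zero, LinearMap.zero_apply, mul_one, eq_comm] at this⟩
    have h2 := (Commute.all _ _).isNilpotent_add hnil ⟨k, hk⟩
    rw [sub_add_cancel, ← Algebra.algebraMap_eq_smul_one] at h2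
    by_contra h0
    exact h2.not_isUnit ((IsUnit.mk0 c h0).map _)
  rw [hskew, hc0, zero_smul, zero_sub, neg_mul, map_neg]

end QuadraticMap

/-! ### Invariance of the orbit closure -/

namespace CyclicRep

variable {n l : ℕ}

/-- If the orbit closure is the quadric `q = 0`, then this quadric is `ρ`-stable. -/
theorem map_ρ_mulVec_eq_zero [NeZero l] (P : CyclicRep n l) {q : QuadraticForm ℂ (Fin l → ℂ)}
    (hX : projZariskiClosure P.orbit = {p | q p.rep = 0}) (a : Multiplicative (Fin n → ℂ))
    {w : Fin l → ℂ} (hw : q w = 0) : q ((P.ρ a).1 *ᵥ w) = 0 := by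
  by_cases h0 : w = 0
  · rw [h0, Matrix.mulVec_zero, map_zero]
  -- `q ∘ ρ(a)` vanishes on the orbit, which `ρ(a)` preserves, hence on its closure.
  obtain ⟨F, hF, hFq⟩ := (q.comp (Matrix.toLin' (P.ρ a).1)).exists_mvPolynomial
  have hmem : Projectivization.mk ℂ w h0 ∈ projZariskiClosure P.orbit := by
    rw [hX, Set.mem_ofPred_eq, QuadraticMap.map_rep_mk_eq_zero_iff]
    exact hw
  have h := hmem 2 F hF ?_
  · rwa [Projectivization.eval_rep_mk_eq_zero_iff hF, hFq] at h
  · rintro _ ⟨b, rfl⟩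
    rw [Projectivization.eval_rep_mk_eq_zero_iff hF, hFq, QuadraticMap.comp_apply,
      Matrix.toLin'_apply, Matrix.mulVec_mulVec, ← Units.val_mul, ← map_mul]
    have hab := subset_projZariskiClosure P.orbit ⟨a * b, rfl⟩
    rw [hX, Set.mem_ofPred_eq, QuadraticMap.map_rep_mk_eq_zero_iff] at hab
    exact hab

/-- The derivative at `t = 0` of `q`, constantly zero along the one-parameter orbit of `w`. -/
theorem polarBilin_dρ_mulVec_eq_zero [NeZero l] (P : CyclicRep n l)
    {q : QuadraticForm ℂ (Fin l → ℂ)}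
    (hX : projZariskiClosure P.orbit = {p | q p.rep = 0}) (i : Fin n)
    {w : Fin l → ℂ} (hw : q w = 0) : q.polarBilin (P.dρ i *ᵥ w) w = 0 := by
  have hd : HasDerivAt (fun t => P.oneParam i t *ᵥ w) (P.dρ i *ᵥ w) 0 := by
    rw [hasDerivAt_pi]
    intro j
    simp only [Matrix.mulVec, dotProduct]
    exact HasDerivAt.fun_sum fun m _ => (P.oneParam_hasDerivAt i j m).mul_const _
  have hbil := (LinearMap.toContinuousBilinearMap q.polarBilin).hasDerivAt_of_bilinear
    (fun _ => hd) (fun _ => hd)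
  have hzero : (fun t => LinearMap.toContinuousBilinearMap q.polarBilin (P.oneParam i t *ᵥ w)
      (P.oneParam i t *ᵥ w)) = fun _ => 0 := by
    funext t
    have h1 : q.polarBilin (P.oneParam i t *ᵥ w) (P.oneParam i t *ᵥ w) = 0 := by
      have h2 : q (P.oneParam i t *ᵥ w) = 0 := P.map_ρ_mulVec_eq_zero hX _ hw
      rw [QuadraticMap.polarBilin_apply_apply, QuadraticMap.polar_self, h2, smul_zero]
    exact h1
  rw [hzero] at hbil
  have h := hbil.unique (hasDerivAt_const (0 : ℂ) (0 : ℂ))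
  rw [oneParam_zero, Matrix.one_mulVec] at h
  have h' : q.polarBilin w (P.dρ i *ᵥ w) + q.polarBilin (P.dρ i *ᵥ w) w = 0 := h
  rw [q.polarBilin_comm w] at h'
  linear_combination h' / 2

end CyclicRep

/-! ### Necessity: skew forms determine `𝔪²` and `B₀` -/

namespace CyclicRep

variable {n : ℕ} {P : CyclicRep n (n + 2)} {μ : Module.Basis (Fin (n + 2)) ℂ P.R}

variable (P) in
-- In particular `n ≥ 1`, so `dim R ≥ 3`, as the comparison of quadratic forms requires.
theorem exists_S_ne_zero (hP : P.Faithful) : ∃ i, P.S i ≠ 0 := by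
  by_contra! h
  refine P.not_maxSub_le_genSpan hP fun x hx => ?_
  have hx' : x ∈ IsLocalRing.maximalIdeal P.R := hx
  rw [maximalIdeal_eq_span_S, Ideal.mem_span_range_iff_exists_fun] at hx'
  obtain ⟨c, rfl⟩ := hx'
  simp [h]

namespace IsProperBasis

theorem coord_zero_eq_zero (hμ : P.IsProperBasis μ) (hP : P.Faithful) {x : P.R}
    (hx : x ∈ P.maxSub) : μ.coord 0 x = 0 := by
  obtain ⟨u, hu, d, rfl⟩ := hμ.exists_decomposition_of_mem hP hx
  have h0 : μ.coord 0 u = 0 := by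
    clear hx
    rw [← hμ.span_middle] at hu
    induction hu using Submodule.span_induction with
    | mem x h =>
      obtain ⟨i, rfl⟩ := h
      simp
    | zero => exact map_zero _
    | add x y _ _ ihx ihy => rw [map_add, ihx, ihy, add_zero]
    | smul c x _ ihx => rw [map_smul, ihx, smul_zero]
  rw [map_add, h0, map_smul, Module.Basis.coord_apply, μ.repr_self,
    Finsupp.single_eq_of_ne (Fin.last_pos).ne, smul_zero, add_zero]

end IsProperBasis

/-- A nondegenerate symmetric form on `R` with isotropic unit for which the generators act by skew
operators. -/
structure IsSkewForm (P : CyclicRep n (n + 2)) (β : LinearMap.BilinForm ℂ P.R) : Prop where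
  nondegenerate : β.Nondegenerate
  comm : ∀ x y, β x y = β y x
  one_one : β 1 1 = 0
  skew : ∀ i x y, β (P.S i * x) y = -β x (P.S i * y)

namespace IsSkewForm

variable {β : LinearMap.BilinForm ℂ P.R}

theorem gen_mul (hβ : P.IsSkewForm β) {u : P.R} (hu : u ∈ P.genSpan) (x y : P.R) :
    β (u * x) y = -β x (u * y) := by
  induction hu using Submodule.span_induction with
  | mem u hu =>
    obtain ⟨i, rfl⟩ := hu
    exact hβ.skew i x y
  | zero => simp
  | add u w _ _ hu hw =>
    rw [add_mul, add_mul, map_add, map_add, LinearMap.add_apply, hu, hw]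
    ring
  | smul c u _ hu =>
    rw [smul_mul_assoc, smul_mul_assoc, map_smul, map_smul, LinearMap.smul_apply, hu, smul_neg]

theorem one_gen (hβ : P.IsSkewForm β) {u : P.R} (hu : u ∈ P.genSpan) : β 1 u = 0 := by
  have h := hβ.gen_mul hu 1 1
  rw [mul_one, hβ.comm u] at h
  linear_combination h / 2

theorem gen_gen (hβ : P.IsSkewForm β) {u w : P.R} (hu : u ∈ P.genSpan) :
    β u w = -β 1 (u * w) := by
  have h := hβ.gen_mul hu 1 w
  rwa [mul_one] at h

/-- Moving `u` and `u'` across gives `β(1, uu'w)`; moving `w` instead gives its negative. -/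
theorem gen_mul_gen_gen (hβ : P.IsSkewForm β) {u u' w : P.R} (hu : u ∈ P.genSpan)
    (hu' : u' ∈ P.genSpan) (hw : w ∈ P.genSpan) : β (u * u') w = 0 := by
  have h1 : β (u * u') w = β 1 (w * (u * u')) := by
    rw [hβ.gen_mul hu, hβ.gen_gen hu', neg_neg]
    congr 1
    ring
  have h2 := hβ.gen_gen hw (w := u * u')
  rw [hβ.comm w] at h2
  linear_combination (h1 + h2) / 2

/-- The orthogonal complement of the maximal ideal contains a socle element outside
`⟨S_1, …, S_n⟩`. -/
theorem exists_socle (hβ : P.IsSkewForm β) (hμ : P.IsProperBasis μ) (hP : P.Faithful) :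
    ∃ e ∈ P.maxSub, e ∉ P.genSpan ∧ (∀ x ∈ P.maxSub, β e x = 0) ∧
      ∀ x ∈ IsLocalRing.maximalIdeal P.R, e * x = 0 := by
  -- `e` represents the coordinate along `1`, which vanishes on `𝔪`. Skewness then gives `Sᵢ e = 0`,
  -- and `β(e,1) = 1` keeps `e` out of `U`.
  let e := (LinearMap.BilinForm.toDual β hβ.nondegenerate).symm (μ.coord 0)
  have he : ∀ x, β e x = μ.coord 0 x := fun x =>
    LinearMap.BilinForm.apply_toDual_symm_apply (hB := hβ.nondegenerate) (μ.coord 0) x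
  have hem : ∀ x ∈ P.maxSub, β e x = 0 := fun x hx => by
    rw [he, hμ.coord_zero_eq_zero hP hx]
  have he1 : β e 1 = 1 := by
    rw [he, ← hμ.first]
    simp
  have hS : ∀ i, P.S i * e = 0 := fun i => hβ.nondegenerate.1 _ fun x => by
    rw [hβ.skew, hem, neg_zero]
    exact Ideal.mul_mem_right _ _ (P.genSpan_le_maxSub (Submodule.subset_span ⟨i, rfl⟩))
  refine ⟨e, ?_, fun h => ?_, hem, fun x hx => ?_⟩
  · change e ∈ IsLocalRing.maximalIdeal P.R
    rw [IsLocalRing.mem_maximalIdeal]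
    intro hu
    obtain ⟨i, hi⟩ := P.exists_S_ne_zero hP
    exact hi ((IsUnit.mul_left_eq_zero hu).mp (hS i))
  · rw [hβ.comm, hβ.one_gen h] at he1
    exact zero_ne_one he1
  · rw [maximalIdeal_eq_span_S, Ideal.mem_span_range_iff_exists_fun] at hx
    obtain ⟨c, rfl⟩ := hx
    rw [Finset.mul_sum]
    refine Finset.sum_eq_zero fun i _ => ?_
    rw [mul_left_comm, mul_comm e, hS, mul_zero]

/-- For `u, u' ∈ U` write `uu' = w + c e` with `w ∈ U`. Then `w` is orthogonal to `U` by
`gen_mul_gen_gen`, and to `e` and `1`, so `w = 0`. As `e` kills `𝔪`, this gives `𝔪² ≤ ⟨e⟩`; equality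
holds because `𝔪² = 0` would force `𝔪 = U`. -/
theorem sq_eq_span (hβ : P.IsSkewForm β) (hμ : P.IsProperBasis μ) (hP : P.Faithful) :
    ∃ e : P.R, e ≠ 0 ∧ (∀ x ∈ P.maxSub, β e x = 0) ∧
      (IsLocalRing.maximalIdeal P.R ^ 2).restrictScalars ℂ = Submodule.span ℂ {e} := by
  obtain ⟨e, hem, heU, heβ, hemul⟩ := hβ.exists_socle hμ hP
  have hdec : ∀ x ∈ P.maxSub, ∃ u ∈ P.genSpan, ∃ c : ℂ, x = u + c • e := by
    intro x hx
    rw [← P.genSpan_sup_span_singleton hP hem heU] at hx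
    obtain ⟨u, hu, y, hy, rfl⟩ := Submodule.mem_sup.mp hx
    obtain ⟨c, rfl⟩ := Submodule.mem_span_singleton.mp hy
    exact ⟨u, hu, c, rfl⟩
  have hgen : ∀ u ∈ P.genSpan, ∀ u' ∈ P.genSpan, u * u' ∈ Submodule.span ℂ {e} := by
    intro u hu u' hu'
    obtain ⟨w, hw, c, hwc⟩ := hdec (u * u')
      (Ideal.mul_mem_right _ _ (P.genSpan_le_maxSub hu))
    have hw0 : w = 0 := by
      refine hβ.nondegenerate.1 _ fun r => ?_
      obtain ⟨a, ha⟩ := P.exists_sub_mem_maximalIdeal r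
      obtain ⟨u'', hu'', b, hb⟩ := hdec _ ha
      have h1 : β w u'' = 0 := by
        have h2 := hβ.gen_mul_gen_gen hu hu' hu''
        rwa [hwc, map_add, LinearMap.add_apply, map_smul, LinearMap.smul_apply,
          heβ _ (P.genSpan_le_maxSub hu''), smul_zero, add_zero] at h2
      rw [sub_eq_iff_eq_add.mp hb, map_add, map_add, map_smul, map_smul, h1, hβ.comm w e,
        heβ _ (P.genSpan_le_maxSub hw), hβ.comm w 1, hβ.one_gen hw]
      simp
    rw [hwc, hw0, zero_add]
    exact Submodule.smul_mem _ _ (Submodule.mem_span_singleton_self e)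
  have hle : (IsLocalRing.maximalIdeal P.R ^ 2).restrictScalars ℂ ≤ Submodule.span ℂ {e} := by
    intro x hx
    have hx' : x ∈ IsLocalRing.maximalIdeal P.R ^ 2 := hx
    rw [pow_two] at hx'
    induction hx' using Submodule.mul_induction_on' with
    | mem_mul_mem a ha b hb =>
      obtain ⟨u, hu, c, rfl⟩ := hdec a ha
      obtain ⟨u', hu', d, rfl⟩ := hdec b hb
      have h1 : (u + c • e) * (u' + d • e) = u * u' := by
        rw [add_mul, smul_mul_assoc, hemul _ hb, smul_zero, add_zero, mul_add, mul_smul_comm,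
          mul_comm u e, hemul _ (P.genSpan_le_maxSub hu), smul_zero, add_zero]
      rw [h1]
      exact hgen u hu u' hu'
    | add a ha b hb iha ihb =>
      rw [← pow_two] at ha hb
      exact Submodule.add_mem _ (iha ha) (ihb hb)
  have he0 : e ≠ 0 := fun h => heU (h ▸ Submodule.zero_mem _)
  refine ⟨e, he0, heβ, le_antisymm hle ((Submodule.span_singleton_le_iff_mem _ _).mpr ?_)⟩
  by_contra hnot
  refine P.not_maxSub_le_genSpan hP (P.maxSub_le_sup.trans (sup_le le_rfl fun x hx => ?_))
  obtain ⟨c, hc⟩ := Submodule.mem_span_singleton.mp (hle hx)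
  by_cases h0 : c = 0
  · rw [← hc, h0, zero_smul]
    exact Submodule.zero_mem _
  · refine absurd ?_ hnot
    have : e = c⁻¹ • x := by rw [← hc, smul_smul, inv_mul_cancel₀ h0, one_smul]
    rw [this]
    exact Submodule.smul_mem _ _ hx

theorem finrank_sq (hβ : P.IsSkewForm β) (hμ : P.IsProperBasis μ) (hP : P.Faithful) :
    Module.finrank ℂ ↥(IsLocalRing.maximalIdeal P.R ^ 2) = 1 := by
  obtain ⟨e, he0, -, h⟩ := hβ.sq_eq_span hμ hP
  have h1 := finrank_span_singleton (K := ℂ) he0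
  rw [← h] at h1
  exact h1

/-- A skew form is a multiple of `B₀`. -/
theorem exists_eq_mul_B₀ (hβ : P.IsSkewForm β) (hμ : P.IsProperBasis μ) (hP : P.Faithful) :
    ∃ κ : ℂ, ∀ x y, β x y = κ * P.B₀ μ x y := by
  obtain ⟨e, -, heβ, he⟩ := hβ.sq_eq_span hμ hP
  have h2 := hμ.sq_eq_span_last hP (hβ.finrank_sq hμ hP)
  set f := μ (Fin.last (n + 1)) with hf
  have hfm : ∀ x ∈ P.maxSub, β f x = 0 := by
    intro x hx
    have h : f ∈ Submodule.span ℂ {e} := by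
      rw [← he, h2]
      exact Submodule.mem_span_singleton_self f
    obtain ⟨c, hc⟩ := Submodule.mem_span_singleton.mp h
    rw [← hc, map_smul, LinearMap.smul_apply, heβ x hx, smul_zero]
  -- The factor is forced by `β(u,u') = -β(1,uu') = -B₀(u,u') β(1,f)` on `U`.
  refine ⟨-β 1 f, fun x y => ?_⟩
  obtain ⟨c, u, hu, d, rfl⟩ := hμ.exists_decomposition hP x
  obtain ⟨c', u', hu', d', rfl⟩ := hμ.exists_decomposition hP y
  rw [hμ.B₀_decomposition hu hu']
  have huu : β u u' = -β 1 f * P.B₀ μ u u' := by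
    rw [hβ.gen_gen hu, hμ.gen_mul_gen h2 hu hu', map_smul, smul_eq_mul]
    ring
  simp only [map_add, map_smul, LinearMap.add_apply, LinearMap.smul_apply, smul_eq_mul,
    hβ.one_one, hβ.one_gen hu', hβ.comm u 1, hβ.one_gen hu, ← hf, hβ.comm u f,
    hfm u (P.genSpan_le_maxSub hu), hfm u' (P.genSpan_le_maxSub hu'), hfm f (hμ.last_mem hP),
    hβ.comm f 1, huu]
  ring

end IsSkewForm

/-- A nondegenerate quadric that is the orbit closure gives rise to a skew form. -/
theorem isSkewForm_of_closure_eq (hP : P.Faithful) {q : QuadraticForm ℂ (Fin (n + 2) → ℂ)}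
    (hq : q.polarBilin.Nondegenerate)
    (hX : projZariskiClosure P.orbit = {p | q p.rep = 0}) :
    P.IsSkewForm (q.comp P.equivV.toLinearMap).polarBilin := by
  have hpol : ∀ x y, (q.comp P.equivV.toLinearMap).polarBilin x y =
      q.polarBilin (P.equivV x) (P.equivV y) := fun x y => by
    rw [QuadraticMap.polarBilin_apply_apply, QuadraticMap.polarBilin_apply_apply,
      QuadraticMap.polar, QuadraticMap.polar, ← map_add]
    rfl
  have hnd : (q.comp P.equivV.toLinearMap).polarBilin.Nondegenerate := by
    constructor
    · intro x hx
      refine P.equivV.map_eq_zero_iff.mp (hq.1 _ fun w => ?_)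
      rw [← P.equivV.apply_symm_apply w, ← hpol]
      exact hx _
    · intro x hx
      refine P.equivV.map_eq_zero_iff.mp (hq.2 _ fun w => ?_)
      rw [← P.equivV.apply_symm_apply w, ← hpol]
      exact hx _
  have hone : q.comp P.equivV.toLinearMap 1 = 0 := by
    have h := (P.orbit_subset_iff q).mp (fun p hp => by
      have := subset_projZariskiClosure _ hp
      rwa [hX] at this) 0
    simpa using h
  have hdim : 3 ≤ Module.finrank ℂ P.R := by
    obtain ⟨i, -⟩ := P.exists_S_ne_zero hP
    have := i.pos
    rw [P.finrank_R]
    omega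
  refine ⟨hnd, QuadraticMap.polarBilin_comm _, ?_, fun i => ?_⟩
  · rw [QuadraticMap.polarBilin_apply_apply, QuadraticMap.polar_self, hone, smul_zero]
  · refine QuadraticMap.polarBilin_mul_eq_neg _ hnd hdim hone (P.isNilpotent_S i) fun y hy => ?_
    rw [hpol, equivV_S_mul]
    exact P.polarBilin_dρ_mulVec_eq_zero hX i hy

end CyclicRep

theorem mainTheorem2 {n : ℕ} (P : CyclicRep n (n + 2)) (hP : P.Faithful) :
    (∃ μ : Module.Basis (Fin (n + 2)) ℂ P.R, P.IsProperBasis μ) ∧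
    ∀ μ : Module.Basis (Fin (n + 2)) ℂ P.R, P.IsProperBasis μ →
      (IsNondegenerateQuadric (projZariskiClosure P.orbit) ↔
        Module.finrank ℂ ↥(IsLocalRing.maximalIdeal P.R ^ 2) = 1 ∧ (P.B₀ μ).Nondegenerate) ∧
      (IsNondegenerateQuadric (projZariskiClosure P.orbit) →
        projZariskiClosure P.orbit =
          {p | P.B₀ μ (P.equivV.symm p.rep) (P.equivV.symm p.rep) = 0}) := by
  refine ⟨P.exists_isProperBasis hP, fun μ hμ => ?_⟩
  have hforward : IsNondegenerateQuadric (projZariskiClosure P.orbit) →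
      Module.finrank ℂ ↥(IsLocalRing.maximalIdeal P.R ^ 2) = 1 ∧ (P.B₀ μ).Nondegenerate := by
    rintro ⟨q, hq, hX⟩
    have hβ := CyclicRep.isSkewForm_of_closure_eq hP hq hX
    obtain ⟨κ, h⟩ := hβ.exists_eq_mul_B₀ hμ hP
    -- Since `β = κ B₀`, the radical of `B₀` lies in that of `β`, which is zero.
    refine ⟨hβ.finrank_sq hμ hP, fun x hx => hβ.nondegenerate.1 x fun y => ?_,
      fun x hx => hβ.nondegenerate.2 x fun y => ?_⟩
    · rw [h, hx y, mul_zero]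
    · rw [h, hx y, mul_zero]
  refine ⟨⟨hforward, ?_⟩, fun h => ?_⟩
  · rintro ⟨h1, hB⟩
    exact ⟨P.quad μ, CyclicRep.nondegenerate_polarBilin_quad hB,
      hμ.projZariskiClosure_orbit_eq hP h1 hB⟩
  · obtain ⟨h1, hB⟩ := hforward h
    exact hμ.projZariskiClosure_orbit_eq hP h1 hB
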